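/- Let $p\ge 3$ be a prime and let $G=(\mathbb{F}_p\times\mathbb{F}_p)\rtimes\mathbb{F}_p^{*}$, where each $a\in\mathbb{F}_p^{*}$ acts on $\mathbb{F}_p\times\mathbb{F}_p$ as the matrix $\mathrm{diag}(a,a^{-1})$. Let $V$ be a finite dimensional $\mathbb{F}_pG$-module. A lift of $V$ over a complete local commutative Noetherian ring $S$ with residue field $\mathbb{F}_p$ is a pair $(M,\varphi)$, where $M$ is an $SG$-module that is free and finitely generated over $S$ and $\varphi:\mathbb{F}_p\otimes_S M\to V$ is an isomorphism of $\mathbb{F}_pG$-modules; an isomorphism of lifts $(M,\varphi)\to(M',\varphi')$ is an isomorphism $f:M\to M'$ of $SG$-modules with $\varphi'\circ(\mathrm{id}\otimes f)=\varphi$. A universal deformation ring $R(G,V)$ of $V$ is a complete local commutative Noetherian ring with residue field $\mathbb{F}_p$ carrying a lift $U$ of $V$ such that, for every such ring $S$, every lift of $V$ over $S$ is isomorphic to the base change of $U$ along a unique local ring homomorphism $R(G,V)\to S$. Then there exists a uniserial $\mathbb{F}_pG$-module $V$ of composition length $p-1$ with $\mathrm{End}_{\mathbb{F}_pG}(V)\cong\mathbb{F}_p$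 which has a universal deformation ring $R(G,V)$, and $$R(G,V)\cong\mathbb{Z}_p[[t]]/(pt).$$ In particular, $R(G,V)/pR(G,V)\cong\mathbb{F}_p[[t]]$ is infinite dimensional over $\mathbb{F}_p$. -/

import Mathlib

open scoped TensorProduct PowerSeries

universe u v

/-- A module is uniserial if its submodules are linearly ordered by inclusion. -/
def IsUniserialModule (A M : Type*) [Ring A] [AddCommGroup M] [Module A M] : Prop :=
  ∀ N₁ N₂ : Submodule A M, N₁ ≤ N₂ ∨ N₂ ≤ N₁

/-- The action of `F_p^*` on `F_p × F_p` in which `a` acts by the matrix `diag(a, a⁻¹)`. -/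
def diagAction (p : ℕ) :
    (ZMod p)ˣ →* MulAut (Multiplicative (ZMod p × ZMod p)) where
  toFun a := AddEquiv.toMultiplicative
    { toFun := fun v => ((a : ZMod p) * v.1, ((a⁻¹ : (ZMod p)ˣ) : ZMod p) * v.2)
      invFun := fun v => (((a⁻¹ : (ZMod p)ˣ) : ZMod p) * v.1, (a : ZMod p) * v.2)
      left_inv := fun v => by ext <;> simp
      right_inv := fun v => by ext <;> simp
      map_add' := fun v w => by ext <;> simp [mul_add] }
  map_one' := by
    ext v : 1
    apply Multiplicative.toAdd.injective
    ext <;> simp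
  map_mul' a b := by
    ext v : 1
    apply Multiplicative.toAdd.injective
    ext <;> simp [mul_assoc, mul_comm, mul_left_comm]

/-- The group `(F_p × F_p) ⋊ F_p^*`. -/
abbrev DiagGroup (p : ℕ) : Type :=
  SemidirectProduct (Multiplicative (ZMod p × ZMod p)) (ZMod p)ˣ (diagAction p)

/-- `R` is a complete local commutative Noetherian ring with residue field `k`, the
identification of the residue field with `k` being given by the structure map `R → k`. -/
class IsCoefficientRing (k : Type*) (R : Type*) [Field k] [CommRing R] [Algebra R k] : Prop
    extends IsLocalRing R, IsNoetherianRing R where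
  residue_surjective : Function.Surjective (algebraMap R k)
  complete : IsAdicComplete (IsLocalRing.maximalIdeal R) R

section Deformations

variable {k G V : Type*} [Field k] [Group G] [AddCommGroup V] [Module k V]

/-- A lift of `V` over `R`: an `RG`-module `M`, free and finitely generated over `R`, together
with an isomorphism of `kG`-modules `φ : k ⊗_R M ≅ V`. -/
structure DefLift (ρ : Representation k G V) (R : Type*) [CommRing R] [Algebra R k] where
  M : Type u
  [addCommGroup : AddCommGroup M]
  [module : Module R M]
  [free : Module.Free R M]
  [finite : Module.Finite R M]
  rep : Representation R G M
  φ : k ⊗[R] M ≃ₗ[k] V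
  equivariant : ∀ (g : G) (c : k) (m : M), φ (c ⊗ₜ[R] rep g m) = ρ g (φ (c ⊗ₜ[R] m))

attribute [instance] DefLift.addCommGroup DefLift.module DefLift.free DefLift.finite

/-- The lift `L` over `S` is isomorphic, as a lift of `V`, to the base change along `α : R → S`
of the lift `U` over `R`: there is an isomorphism of `SG`-modules `S ⊗_R U ≅ L` which is
compatible with the identifications of both reductions to `k` with `V`
(by `k`-linearity it suffices to compare them on the elements `1 ⊗ (1 ⊗ m)`). -/
def DefLift.ArisesFrom {ρ : Representation k G V} {R S : Type*} [CommRing R] [Algebra R k]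
    [CommRing S] [Algebra S k] (L : DefLift ρ S) (U : DefLift ρ R) (α : R →+* S) : Prop :=
  letI : Algebra R S := α.toAlgebra
  ∃ e : S ⊗[R] U.M ≃ₗ[S] L.M,
    (∀ (g : G) (s : S) (m : U.M), e (s ⊗ₜ[R] U.rep g m) = L.rep g (e (s ⊗ₜ[R] m))) ∧
    ∀ m : U.M, L.φ ((1 : k) ⊗ₜ[S] e ((1 : S) ⊗ₜ[R] m)) = U.φ ((1 : k) ⊗ₜ[R] m)

/-- `R` is a universal deformation ring of `V`: it carries a lift `U` of `V` such that every
lift of `V` over a complete local commutative Noetherian ring `S` with residue field `k` is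
isomorphic to the base change of `U` along a unique morphism `R → S`. Morphisms are ring
homomorphisms inducing the identity on `k`; these are automatically local and continuous, and,
when `k` is perfect of positive characteristic, linear over the Witt vectors of `k`. -/
def IsUniversalDeformationRing (ρ : Representation k G V) (R : Type u) [CommRing R]
    [Algebra R k] : Prop :=
  IsCoefficientRing k R ∧
    ∃ U : DefLift.{u} ρ R,
      ∀ (S : Type v) [CommRing S] [Algebra S k] [IsCoefficientRing k S] (L : DefLift.{v} ρ S),
        ∃! α : R →+* S, (algebraMap S k).comp α = algebraMap R k ∧ L.ArisesFrom U α

end Deformations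

/-! Write `ζ` for a root of the `p`-th cyclotomic polynomial `Φ` and `π = ζ - 1`. Take `V = F_p[ζ] =
F_p[π]/(π^(p-1))`, where `x = (1, 0)` multiplies by `ζ`, `y = (0, 1)` acts trivially and `a ∈ F_p^*`
acts by `σ_a : ζ ↦ ζ^a`. Submodules are ideals, so `V` is uniserial. An endomorphism is determined
by the image of `1`, which is Galois-fixed, hence scalar, since `σ_a` acts on `π^i/π^(i+1)` by
`a^i`.

Let `M` lift `V` over `S`. As `p - 1` is a unit in `S`, the vector `1` lifts to an `F_p^*`-fixed
vector `e`, and by Nakayama `e, xe, …, x^(p-2)e` is a basis. Symmetry under `F_p^*` forces `Φ(x)e =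
0` (`sum_pow_apply_eq_zero`), so `M ≅ S[ζ]` with the standard action of `x` and of `F_p^*`: this
part does not deform. As `y` commutes with `x`, it multiplies by some `β ≡ 1` modulo the maximal
ideal, with `β^p = 1` and `σ_a β = β^(a⁻¹)`. Comparing `a^i` with `a⁻¹` on the graded pieces pushes
`β - 1` into `π^(p-2)S[ζ]`, and `β^p = 1` then gives `β = 1 + rπ^(p-2)` with `pr = 0`
(`exists_eq_one_add_smul`). Conversely every such `r` in the maximal ideal gives a lift (`stdRep`).

Lifts over `S` are thus parametrized by the `r` in the maximal ideal with `pr = 0`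
(`exists_arisesFrom_iff`), as are the homomorphisms to `S` from `Z_p[[t]]/(pt)`
(`existsUnique_ringHom`). That ring is realized as `Z_p ×_{F_p} F_p[[t]]`, where completeness can be
checked on each factor. -/

open Polynomial in
/-- The ring `S[ζ]`, where `ζ` is a root of the `p`-th cyclotomic polynomial. -/
abbrev CycRing (p : ℕ) (S : Type*) [CommRing S] : Type _ := AdjoinRoot (cyclotomic p S)

/-! ### The ring `S[ζ]` and the element `π = ζ - 1`. -/

namespace CycRing

open Polynomial

section Basic

variable (p : ℕ) [Fact p.Prime] (S : Type*) [CommRing S]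

/-- The root `ζ`. -/
noncomputable abbrev zeta : CycRing p S := AdjoinRoot.root (cyclotomic p S)

/-- The element `ζ - 1`. -/
noncomputable def unif : CycRing p S := zeta p S - 1

lemma geom_sum_zeta : ∑ i ∈ Finset.range p, zeta p S ^ i = 0 := by
  have h := AdjoinRoot.mk_self (f := cyclotomic p S)
  conv_lhs at h => rw [congrArg (AdjoinRoot.mk (cyclotomic p S)) (cyclotomic_prime S p)]
  simpa using h

lemma zeta_pow : zeta p S ^ p = 1 := by
  have := geom_sum_mul (zeta p S) p
  rw [geom_sum_zeta, zero_mul] at this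
  exact (sub_eq_zero.mp this.symm)

lemma natDegree_cyclotomic_prime [Nontrivial S] : (cyclotomic p S).natDegree = p - 1 := by
  rw [natDegree_cyclotomic, Nat.totient_prime Fact.out]

/-- Modulo `p`, `(X - 1)^p = X^p - 1` gives `Φ = (X - 1)^(p-1)`. The congruence is proved over `ℤ`
and evaluated at `ζ`, so no assumption on `S` is needed. -/
lemma exists_unif_pow_eq : ∃ g : CycRing p S, unif p S ^ (p - 1) = p * g := by
  have hp : p.Prime := Fact.out
  obtain ⟨g, hg⟩ : ∃ g : ℤ[X], (X - 1) ^ (p - 1) = cyclotomic p ℤ + C (p : ℤ) * g := by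
    have h : (C (p : ℤ)) ∣ (X - 1) ^ (p - 1) - cyclotomic p ℤ := by
      rw [C_dvd_iff_dvd_coeff]
      intro i
      have h2 : ((X - 1) ^ (p - 1) - cyclotomic p ℤ).map (Int.castRingHom (ZMod p)) = 0 := by
        have h3 : (cyclotomic p (ZMod p)) * (X - 1) = (X - 1) ^ (p - 1) * (X - 1) := by
          rw [cyclotomic_prime_mul_X_sub_one, ← pow_succ, Nat.sub_add_cancel hp.one_le,
            sub_pow_char, one_pow]
        have h4 : (X - 1 : (ZMod p)[X]) ≠ 0 := by simpa using X_sub_C_ne_zero (1 : ZMod p)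
        simp [← mul_right_cancel₀ h4 h3]
      rw [← ZMod.intCast_zmod_eq_zero_iff_dvd]
      rw [← eq_intCast (Int.castRingHom (ZMod p)), ← coeff_map, h2, coeff_zero]
    obtain ⟨g, hg⟩ := h
    exact ⟨g, by rw [← hg]; ring⟩
  refine ⟨aeval (zeta p S) g, ?_⟩
  have h5 : aeval (zeta p S) (cyclotomic p ℤ) = 0 := by
    rw [cyclotomic_prime ℤ p]
    simpa using geom_sum_zeta p S
  have := congrArg (aeval (zeta p S)) hg
  simpa [h5, unif] using this

variable [Nontrivial S]

/-- The basis `1, ζ, …, ζ ^ (p - 2)`. -/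
noncomputable def basis : Module.Basis (Fin (p - 1)) S (CycRing p S) :=
  (AdjoinRoot.powerBasis' (cyclotomic.monic p S)).basis.reindex
    (finCongr (by simpa using natDegree_cyclotomic_prime p S))

@[simp] lemma basis_apply (i : Fin (p - 1)) : basis p S i = zeta p S ^ (i : ℕ) := by
  simp [basis]

instance : Module.Free S (CycRing p S) := .of_basis (basis p S)
instance : Module.Finite S (CycRing p S) := .of_basis (basis p S)

lemma finrank_eq : Module.finrank S (CycRing p S) = p - 1 := by
  simp [Module.finrank_eq_card_basis (basis p S)]

/-- The coefficient of `ζ ^ (p - 2)`. -/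
noncomputable def topCoeff : CycRing p S →ₗ[S] S :=
  (lcoeff S (p - 2)).comp (AdjoinRoot.modByMonicHom (cyclotomic.monic p S))

/-- `(X - 1)^(p-2)` is monic of degree below that of `Φ`, so it is already reduced. Hence `r` can be
read off from `rπ^(p-2)`. -/
lemma topCoeff_unif : topCoeff p S (unif p S ^ (p - 2)) = 1 := by
  have hp : 2 ≤ p := (Fact.out : p.Prime).two_le
  have h1 : unif p S ^ (p - 2) = AdjoinRoot.mk (cyclotomic p S) ((X - C 1) ^ (p - 2)) := by
    simp [unif]
  have h2 : ((X - C 1 : S[X]) ^ (p - 2)).Monic := (monic_X_sub_C 1).pow _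
  have h3 : ((X - C 1 : S[X]) ^ (p - 2)).natDegree = p - 2 := by
    rw [(monic_X_sub_C 1).natDegree_pow, natDegree_X_sub_C, mul_one]
  rw [topCoeff, LinearMap.comp_apply, h1, AdjoinRoot.modByMonicHom_mk,
    (modByMonic_eq_self_iff (cyclotomic.monic p S)).2, lcoeff_apply]
  · have := h2.coeff_natDegree
    rwa [h3] at this
  · rw [degree_eq_natDegree h2.ne_zero, degree_eq_natDegree (cyclotomic.monic p S).ne_zero, h3,
      natDegree_cyclotomic_prime]
    exact_mod_cast (by omega : p - 2 < p - 1)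

lemma smul_unif_injective {r s : S} (h : r • unif p S ^ (p - 2) = s • unif p S ^ (p - 2)) :
    r = s := by
  simpa [topCoeff_unif] using congrArg (topCoeff p S) h

end Basic

/-! ### The Galois action and the `π`-adic filtration. -/

section Galois

lemma aeval_sub_dvd_sub {S B : Type*} [CommRing S] [CommRing B] [Algebra S B] (a b : B)
    (f : S[X]) : a - b ∣ aeval a f - aeval b f := by
  rw [aeval_def, aeval_def, ← eval_map, ← eval_map]
  exact sub_dvd_eval_sub a b _

lemma _root_.pow_val_natCast {M : Type*} [Monoid M] {w : M} {p : ℕ} (h : w ^ p = 1) (n : ℕ) :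
    w ^ (n : ZMod p).val = w ^ n := by
  rw [ZMod.val_natCast, ← pow_eq_pow_mod n h]

lemma _root_.pow_val_add {M : Type*} [Monoid M] {w : M} {p : ℕ} [NeZero p] (h : w ^ p = 1)
    (a b : ZMod p) : w ^ (a + b).val = w ^ a.val * w ^ b.val := by
  rw [← pow_add, ← pow_val_natCast h (a.val + b.val)]
  simp

lemma _root_.pow_val_mul {M : Type*} [Monoid M] {w : M} {p : ℕ} [NeZero p] (h : w ^ p = 1)
    (a b : ZMod p) : w ^ (a * b).val = (w ^ a.val) ^ b.val := by
  rw [← pow_mul, ← pow_val_natCast h (a.val * b.val)]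
  simp

lemma _root_.ZMod.sum_val {M : Type*} [AddCommMonoid M] (p : ℕ) [NeZero p] (f : ℕ → M) :
    ∑ i : ZMod p, f i.val = ∑ i ∈ Finset.range p, f i := by
  refine Finset.sum_bij (fun i _ => i.val) (fun i _ => Finset.mem_range.2 i.val_lt)
    (fun i _ j _ h => ZMod.val_injective p h) (fun j hj => ⟨j, Finset.mem_univ _, ?_⟩)
    (fun _ _ => rfl)
  exact ZMod.val_natCast_of_lt (Finset.mem_range.1 hj)

/-- Modulo `ζ - 1`, `f(ζ)` is the scalar `f(1)`. -/
lemma exists_eq_smul_one_add {p : ℕ} {S : Type*} [CommRing S] (b : CycRing p S) :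
    ∃ (c : S) (d : CycRing p S),
    b = c • 1 + unif p S * d := by
  induction b using AdjoinRoot.induction_on with | ih f =>
  obtain ⟨d, hd⟩ := aeval_sub_dvd_sub (zeta p S) 1 f
  refine ⟨f.eval 1, d, ?_⟩
  have : aeval (1 : CycRing p S) f = f.eval 1 • 1 := by
    rw [← map_one (algebraMap S (CycRing p S)), aeval_algebraMap_apply, Algebra.smul_def]
    simp
  rw [← AdjoinRoot.aeval_eq, ← this, unif, ← hd]
  ring

/-- The refinement keeps both parts in `J`; it is needed when `J` is the annihilator of `p`. -/
lemma exists_eq_smul_one_add_of_mem {p : ℕ} {S : Type*} [CommRing S] {J : Ideal S}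
    {b : CycRing p S} (hb : b ∈ J.map (algebraMap S (CycRing p S))) :
    ∃ c ∈ J, ∃ d ∈ J.map (algebraMap S (CycRing p S)), b = c • 1 + unif p S * d := by
  induction hb using Submodule.span_induction with
  | mem x hx =>
    obtain ⟨s, hs, rfl⟩ := hx
    exact ⟨s, hs, 0, zero_mem _, by simp [Algebra.smul_def]⟩
  | zero => exact ⟨0, zero_mem _, 0, zero_mem _, by simp⟩
  | add x y _ _ hx hy =>
    obtain ⟨c, hc, d, hd, rfl⟩ := hx
    obtain ⟨c', hc', d', hd', rfl⟩ := hy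
    exact ⟨c + c', add_mem hc hc', d + d', add_mem hd hd', by rw [add_smul]; ring⟩
  | smul r x hx' hx =>
    obtain ⟨c, hc, d, hd, rfl⟩ := hx
    obtain ⟨c', d', rfl⟩ := exists_eq_smul_one_add r
    refine ⟨c' * c, Ideal.mul_mem_left _ _ hc, d' * (c • 1 + unif p S * d) + c' • d,
      add_mem (Ideal.mul_mem_left _ _ hx') (Submodule.smul_of_tower_mem _ _ hd), ?_⟩
    simp only [smul_eq_mul, Algebra.smul_def, map_mul]
    ring

variable (p : ℕ) [Fact p.Prime] (S : Type*) [CommRing S]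

/-- The automorphism `ζ ↦ ζ ^ a`. -/
noncomputable def galois (a : (ZMod p)ˣ) : CycRing p S →ₐ[S] CycRing p S :=
  AdjoinRoot.liftAlgHom (cyclotomic p S) (Algebra.ofId S _) (zeta p S ^ (a : ZMod p).val) (by
    -- Multiplication by `a` permutes `ZMod p`, so the geometric sum at `ζ^a` is the one at `ζ`,
    -- which vanishes.
    have h : ∑ i : ZMod p, (zeta p S ^ (a : ZMod p).val) ^ i.val = 0 := by
      simp_rw [← pow_val_mul (zeta_pow p S)]
      rw [show ∑ i : ZMod p, zeta p S ^ ((a : ZMod p) * i).val = ∑ i : ZMod p, zeta p S ^ i.val from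
        Equiv.sum_comp (Units.mulLeft a) (fun i : ZMod p => zeta p S ^ i.val),
        ZMod.sum_val p (fun i => zeta p S ^ i), geom_sum_zeta]
    rw [ZMod.sum_val p (fun i => (zeta p S ^ (a : ZMod p).val) ^ i)] at h
    rw [congrArg (eval₂ (R := S) _ _) (cyclotomic_prime S p), eval₂_finsetSum]
    simpa using h)

@[simp] lemma galois_zeta (a : (ZMod p)ˣ) :
    galois p S a (zeta p S) = zeta p S ^ (a : ZMod p).val := by
  simp [galois]

lemma galois_one (b : CycRing p S) : galois p S 1 b = b := by
  have : galois p S 1 = AlgHom.id S _ := by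
    apply AdjoinRoot.algHom_ext
    have : Fact (1 < p) := ⟨(Fact.out : p.Prime).one_lt⟩
    simp [ZMod.val_one]
  rw [this]; rfl

lemma galois_mul (a a' : (ZMod p)ˣ) (b : CycRing p S) :
    galois p S (a * a') b = galois p S a (galois p S a' b) := by
  have : galois p S (a * a') = (galois p S a).comp (galois p S a') := by
    apply AdjoinRoot.algHom_ext
    simp [pow_val_mul (zeta_pow p S)]
  rw [this]; rfl

variable {p S}

lemma exists_galois_eq_add (a : (ZMod p)ˣ) (b : CycRing p S) :
    ∃ c, galois p S a b = b + unif p S * c := by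
  induction b using AdjoinRoot.induction_on with | ih f =>
  have h1 : galois p S a (AdjoinRoot.mk _ f) = aeval (zeta p S ^ (a : ZMod p).val) f := by
    rw [← AdjoinRoot.aeval_eq, ← aeval_algHom_apply, galois_zeta]
  have h2 : unif p S ∣ zeta p S ^ (a : ZMod p).val - zeta p S := by
    have h3 := sub_dvd_pow_sub_pow (zeta p S) 1 (a : ZMod p).val
    rw [one_pow] at h3
    have := dvd_sub h3 (dvd_refl (unif p S))
    simpa [unif] using this
  obtain ⟨c, hc⟩ := h2.trans (aeval_sub_dvd_sub _ _ f)
  exact ⟨c, by rw [h1, ← hc, ← AdjoinRoot.aeval_eq]; ring⟩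

/-- The quotient `(ζ^a - 1)/(ζ - 1) = 1 + ζ + … + ζ^(a-1)` is `a` modulo `π`; thus `σ_a` acts on
`π^i/π^(i+1)` by `a^i`. -/
lemma exists_galois_unif (a : (ZMod p)ˣ) :
    ∃ c, galois p S a (unif p S) = unif p S * ((a : ZMod p).val + unif p S * c) := by
  have h : ∃ c, ∑ i ∈ Finset.range (a : ZMod p).val, zeta p S ^ i =
      (a : ZMod p).val + unif p S * c := by
    have h2 : unif p S ∣ ∑ i ∈ Finset.range (a : ZMod p).val, (zeta p S ^ i - 1) :=
      Finset.dvd_sum fun i _ => by simpa [unif] using sub_dvd_pow_sub_pow (zeta p S) 1 i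
    obtain ⟨c, hc⟩ := h2
    refine ⟨c, ?_⟩
    rw [← hc, Finset.sum_sub_distrib]
    simp
  obtain ⟨c, hc⟩ := h
  refine ⟨c, ?_⟩
  rw [← hc, mul_comm, unif, geom_sum_mul]
  simp

variable (J : Ideal S)

local notation "N" => Ideal.map (algebraMap S (CycRing p S)) J

lemma exists_galois_eq_add_of_mem (a : (ZMod p)ˣ) {b : CycRing p S} (hb : b ∈ N) :
    ∃ c ∈ N, galois p S a b = b + unif p S * c := by
  induction hb using Submodule.span_induction with
  | mem x hx =>
    obtain ⟨s, -, rfl⟩ := hx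
    exact ⟨0, zero_mem _, by rw [AlgHom.commutes]; simp⟩
  | zero => exact ⟨0, zero_mem _, by simp⟩
  | add x y _ _ hx hy =>
    obtain ⟨c, hc, h⟩ := hx
    obtain ⟨c', hc', h'⟩ := hy
    exact ⟨c + c', add_mem hc hc', by rw [map_add, h, h']; ring⟩
  | smul r x hx' hx =>
    obtain ⟨c, hc, h⟩ := hx
    obtain ⟨c', h'⟩ := exists_galois_eq_add a r
    refine ⟨r * c + c' * x + c' * unif p S * c,
      add_mem (add_mem (Ideal.mul_mem_left _ _ hc) (Ideal.mul_mem_left _ _ hx'))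
        (Ideal.mul_mem_left _ _ hc), ?_⟩
    rw [smul_eq_mul, map_mul, h, h']
    ring

/-- Comparison of leading terms in the `unif`-adic filtration. -/
lemma leading_term_step (a : (ZMod p)ˣ) (i : ℕ) (u : S)
    (hu : IsUnit (((a : ZMod p).val : S) ^ i - u)) {γ : CycRing p S}
    (hγ : ∃ κ ∈ N, γ = unif p S ^ i * κ)
    (h : ∃ κ ∈ N, galois p S a γ = u • γ + unif p S ^ (i + 1) * κ) :
    ∃ κ ∈ N, γ = unif p S ^ (i + 1) * κ := by
  obtain ⟨κ, hκ, rfl⟩ := hγ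
  obtain ⟨κ', hκ', h⟩ := h
  obtain ⟨c, hc, hcκ⟩ := exists_galois_eq_add_of_mem J a hκ
  obtain ⟨v, hv⟩ := exists_galois_unif (S := S) a
  obtain ⟨q, hq⟩ : unif p S ∣ (((a : ZMod p).val : CycRing p S) + unif p S * v) ^ i -
      ((a : ZMod p).val : CycRing p S) ^ i :=
    (Dvd.intro v (by ring)).trans (sub_dvd_pow_sub_pow _ _ i)
  rw [map_mul, map_pow, hv, hcκ, mul_pow, sub_eq_iff_eq_add.1 hq] at h
  -- Since `σ_a(π^i κ) ≡ a^i π^i κ`, the hypothesis puts `(a^i - u)π^i κ` in `π^(i+1)N`; now divide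
  -- by the unit `w = a^i - u`.
  obtain ⟨w, hw⟩ := hu
  refine ⟨((w⁻¹ : Sˣ) : S) • (κ' - q * (κ + unif p S * c) -
    ((a : ZMod p).val : CycRing p S) ^ i * c),
    Submodule.smul_of_tower_mem _ _ (sub_mem (sub_mem hκ' (Ideal.mul_mem_left _ _
      (add_mem hκ (Ideal.mul_mem_left _ _ hc)))) (Ideal.mul_mem_left _ _ hc)), ?_⟩
  have h1 : unif p S ^ i * κ = ((w⁻¹ : Sˣ) : S) • ((w : S) • (unif p S ^ i * κ)) := by
    rw [smul_smul]; simp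
  rw [h1, hw, mul_smul_comm]
  congr 1
  simp only [Algebra.smul_def, map_sub, map_pow, map_natCast] at h ⊢
  linear_combination h

end Galois
end CycRing

/-! ### Units modulo `p` and binomial expansions. -/

lemma ZMod.natCast_two_ne_zero {p : ℕ} (hp : 3 ≤ p) : ((2 : ℕ) : ZMod p) ≠ 0 := by
  rw [Ne, ZMod.natCast_eq_zero_iff]
  exact fun h => by have := Nat.le_of_dvd two_pos h; omega

lemma ZMod.exists_unit_pow_ne_one (p : ℕ) [Fact p.Prime] {i : ℕ} (h0 : 0 < i) (h1 : i < p - 1) :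
    ∃ a : (ZMod p)ˣ, a ^ i ≠ 1 := by
  obtain ⟨a, ha⟩ := IsCyclic.exists_generator (α := (ZMod p)ˣ)
  refine ⟨a, fun h => ?_⟩
  have h2 : orderOf a = p - 1 := by
    rw [orderOf_eq_card_of_forall_mem_zpowers ha, Nat.card_eq_fintype_card, ZMod.card_units]
  have := Nat.le_of_dvd h0 (orderOf_dvd_of_pow_eq_one h)
  omega

lemma exists_one_add_pow_prime_eq (p : ℕ) (hp : p.Prime) {B : Type*} [CommRing B] (γ : B) :
    ∃ q : B, (1 + γ) ^ p = 1 + γ ^ p + p * γ * (1 + γ * q) := by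
  open Polynomial in
  obtain ⟨r, hr⟩ := exists_add_pow_prime_eq hp (1 : ℤ[X]) X
  have h1 := congrArg (fun f => Polynomial.coeff f 1) hr
  have hp1 : 1 ≠ p := hp.one_lt.ne
  -- The coefficient of `X` in `(1 + X)^p` is exactly `p`, which fixes the leading term of the
  -- middle binomial terms.
  have h2 : r.coeff 0 = 1 := by
    have h3 : ((p : Polynomial ℤ) * 1 * Polynomial.X * r).coeff 1 = p * r.coeff 0 := by
      rw [mul_one, mul_assoc, ← Polynomial.C_eq_natCast, Polynomial.coeff_C_mul,
        show (1 : ℕ) = 0 + 1 from rfl, Polynomial.coeff_X_mul]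
    simp only [Polynomial.coeff_add, h3, one_pow, Polynomial.coeff_one_add_X_pow,
      Polynomial.coeff_X_pow, Polynomial.coeff_one] at h1
    have h4 : (p : ℤ) ≠ 0 := by exact_mod_cast hp.ne_zero
    apply mul_left_cancel₀ h4
    simpa [hp1] using h1.symm
  obtain ⟨q, hq⟩ : Polynomial.X ∣ r - 1 := by
    rw [Polynomial.X_dvd_iff]; simp [h2]
  refine ⟨Polynomial.aeval γ q, ?_⟩
  have := congrArg (Polynomial.aeval γ) hr
  rw [sub_eq_iff_eq_add.1 hq] at this
  simp only [map_pow, map_add, map_mul, map_one, map_natCast, Polynomial.aeval_X] at this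
  rw [this]; ring

lemma exists_one_add_pow_eq {B : Type*} [CommRing B] (γ : B) (n : ℕ) :
    ∃ q : B, (1 + γ) ^ n = 1 + n * γ + γ ^ 2 * q := by
  induction n with
  | zero => exact ⟨0, by simp⟩
  | succ n ih =>
    obtain ⟨q, hq⟩ := ih
    exact ⟨n + q + q * γ, by rw [pow_succ, hq]; push_cast; ring⟩

/-! ### Roots of unity on which Galois acts by the inverse cyclotomic character. -/

namespace CycRing

variable {p : ℕ} [Fact p.Prime] {S : Type*} [CommRing S]

/-- If `γ ∈ π^i` with `i ≥ 1`, then modulo `π^(i+1)` the element `σ_a γ` is `a^i γ` and also `a⁻¹γ`,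
because `γ²` is negligible. Some `a` has `a^(i+1) ≠ 1` as long as `i + 1 < p - 1`, so the climb
stops only at `π^(p-2)`. -/
lemma exists_eq_unif_pow_mul (hp : 3 ≤ p) (hS : ∀ n : ℤ, (n : ZMod p) ≠ 0 → IsUnit (n : S))
    (J : Ideal S) {γ : CycRing p S} (h1 : (1 + γ) ^ p = 1)
    (h2 : ∀ a : (ZMod p)ˣ, galois p S a (1 + γ) = (1 + γ) ^ ((a⁻¹ : (ZMod p)ˣ) : ZMod p).val)
    (hγ : γ ∈ J.map (algebraMap S (CycRing p S))) :
    ∃ κ ∈ J.map (algebraMap S (CycRing p S)), γ = unif p S ^ (p - 2) * κ := by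
  suffices h : ∀ i ≤ p - 2, ∃ κ ∈ J.map (algebraMap S (CycRing p S)), γ = unif p S ^ i * κ from
    h _ le_rfl
  intro i
  induction i with
  | zero => exact fun _ => ⟨γ, hγ, by simp⟩
  | succ i ih =>
    intro hi
    obtain ⟨κ, hκ, hγκ⟩ := ih (by omega)
    rcases Nat.eq_zero_or_pos i with rfl | hi0
    -- For `i = 0` the square of `γ` is not negligible. Take `a⁻¹ = 2`: then `β² = σ_a β ≡ β` modulo
    -- `π` for `β = 1 + γ`, and the unit `β` cancels.
    · have h20 : ((2 : ℕ) : ZMod p) ≠ 0 := ZMod.natCast_two_ne_zero hp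
      let a : (ZMod p)ˣ := (Units.mk0 _ h20)⁻¹
      obtain ⟨c, hc, hcγ⟩ := exists_galois_eq_add_of_mem J a hγ
      have h3 := h2 a
      have h4 : ((a⁻¹ : (ZMod p)ˣ) : ZMod p).val = 2 := by
        simp only [a, inv_inv, Units.val_mk0]
        exact ZMod.val_natCast_of_lt (by omega)
      rw [h4, map_add, map_one, hcγ] at h3
      have h5 : (1 + γ) * (1 + γ) ^ (p - 1) = 1 := by
        rw [← pow_succ', Nat.sub_add_cancel (by omega), h1]
      refine ⟨(1 + γ) ^ (p - 1) * c, Ideal.mul_mem_left _ _ hc, ?_⟩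
      linear_combination (-γ) * h5 - (1 + γ) ^ (p - 1) * h3
    · obtain ⟨a, ha⟩ := ZMod.exists_unit_pow_ne_one p (i := i + 1) (by omega) (by omega)
      refine leading_term_step J a i ((((a⁻¹ : (ZMod p)ˣ) : ZMod p).val : ℕ) : S) ?_ ⟨κ, hκ, hγκ⟩ ?_
      · have := hS (((a : ZMod p).val : ℤ) ^ i - (((a⁻¹ : (ZMod p)ˣ) : ZMod p).val : ℤ)) ?_
        · rwa [Int.cast_sub, Int.cast_pow, Int.cast_natCast, Int.cast_natCast] at this
        · intro h
          apply ha
          have h3 : a ^ i = a⁻¹ := by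
            ext
            rwa [Int.cast_sub, Int.cast_pow, Int.cast_natCast, Int.cast_natCast,
              ZMod.natCast_zmod_val, ZMod.natCast_zmod_val, sub_eq_zero, ← Units.val_pow_eq_pow_val]
              at h
          rw [pow_succ, h3, inv_mul_cancel]
      · obtain ⟨q, hq⟩ := exists_one_add_pow_eq γ ((a⁻¹ : (ZMod p)ˣ) : ZMod p).val
        refine ⟨unif p S ^ (i - 1) * κ * κ * q, ?_, ?_⟩
        · exact Ideal.mul_mem_right _ _ (Ideal.mul_mem_left _ _ hκ)
        · have h3 := h2 a
          rw [map_add, map_one, hq] at h3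
          have h4 : unif p S ^ i = unif p S ^ (i - 1) * unif p S := by
            rw [← pow_succ, Nat.sub_add_cancel hi0]
          have h5 : γ ^ 2 = unif p S ^ (i + 1) * (unif p S ^ (i - 1) * κ * κ) := by
            rw [hγκ]
            linear_combination unif p S ^ i * κ ^ 2 * h4
          rw [Algebra.smul_def, map_natCast]
          linear_combination h3 + q * h5

lemma linearMap_mem_of_mem_map {B : Type*} [CommRing B] [Algebra S B] (f : B →ₗ[S] S)
    {J : Ideal S} {b : B} (hb : b ∈ J.map (algebraMap S B)) : f b ∈ J := by
  have h : b ∈ (J • ⊤ : Submodule S B) := by rwa [Ideal.smul_top_eq_map]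
  refine Submodule.smul_induction_on h (fun r hr n _ => ?_) fun x y hx hy => ?_
  · rw [map_smul]
    exact Ideal.mul_mem_right _ _ hr
  · rw [map_add]
    exact add_mem hx hy

section Local

variable [IsLocalRing S]

/-- Every maximal ideal of `S[ζ]` lies over that of `S` by integrality, and contains `π` because
`π^(p-1) ∈ pS[ζ]`. So `c + πd` is in the Jacobson radical. -/
lemma isUnit_one_add_mul (hpS : (p : S) ∈ IsLocalRing.maximalIdeal S) {c : S}
    (hc : c ∈ IsLocalRing.maximalIdeal S) (d y : CycRing p S) :
    IsUnit (1 + (c • 1 + unif p S * d) * y) := by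
  by_contra h
  obtain ⟨P, hP, hmem⟩ := exists_max_ideal_of_mem_nonunits h
  have h1 : (P.comap (algebraMap S (CycRing p S))) = IsLocalRing.maximalIdeal S :=
    IsLocalRing.eq_maximalIdeal (Ideal.isMaximal_comap_of_isIntegral_of_isMaximal P)
  have h2 : ∀ s ∈ IsLocalRing.maximalIdeal S, algebraMap S (CycRing p S) s ∈ P := by
    intro s hs
    rwa [← h1] at hs
  have h3 : unif p S ∈ P := by
    obtain ⟨g, hg⟩ := exists_unif_pow_eq p S
    apply hP.isPrime.mem_of_pow_mem (p - 1)
    rw [hg, ← map_natCast (algebraMap S (CycRing p S))]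
    exact Ideal.mul_mem_right _ _ (h2 _ hpS)
  apply hP.ne_top
  rw [Ideal.eq_top_iff_one]
  have h4 : (c • 1 + unif p S * d) * y ∈ P := by
    refine Ideal.mul_mem_right _ _ (add_mem ?_ (Ideal.mul_mem_right _ _ h3))
    rw [Algebra.smul_def]
    exact Ideal.mul_mem_right _ _ (h2 _ hc)
  simpa using sub_mem hmem h4

/-- A `p`-th root of unity in `S[ζ]` on which the Galois group acts through the inverse of the
cyclotomic character is of the form `1 + r (ζ - 1) ^ (p - 2)` with `p r = 0`. -/
theorem exists_eq_one_add_smul (hp : 3 ≤ p)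
    (hS : ∀ n : ℤ, (n : ZMod p) ≠ 0 → IsUnit (n : S))
    (hpS : (p : S) ∈ IsLocalRing.maximalIdeal S) {β : CycRing p S} (h1 : β ^ p = 1)
    (h2 : ∀ a : (ZMod p)ˣ, galois p S a β = β ^ ((a⁻¹ : (ZMod p)ˣ) : ZMod p).val)
    (hβ : β - 1 ∈ (IsLocalRing.maximalIdeal S).map (algebraMap S (CycRing p S))) :
    ∃ r ∈ IsLocalRing.maximalIdeal S, (p : S) * r = 0 ∧ β = 1 + r • unif p S ^ (p - 2) := by
  obtain ⟨γ, rfl⟩ : ∃ γ, β = 1 + γ := ⟨β - 1, by ring⟩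
  rw [add_sub_cancel_left] at hβ
  obtain ⟨g, hg⟩ := exists_unif_pow_eq p S
  have hpp : p - 2 + 1 = p - 1 := by omega
  -- First pass, with `J = ⊤`: since `γ²` is divisible by `π^(p-1) = pg`, the relation `(1 + γ)^p =
  -- 1` becomes `pγ` times a unit equals `0`.
  have hpγ : (p : CycRing p S) * γ = 0 := by
    obtain ⟨κ, -, hκ⟩ := exists_eq_unif_pow_mul hp hS ⊤ h1 h2 (by simp [Ideal.map_top])
    obtain ⟨c, d, rfl⟩ := exists_eq_smul_one_add κ
    -- As `π^(p-2) · πd = pgd`, the top coefficient of `γ` is `c` modulo `p`, and it lies in the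
    -- maximal ideal.
    have hc : c ∈ IsLocalRing.maximalIdeal S := by
      have h3 : γ = c • unif p S ^ (p - 2) + (p : S) • (g * d) := by
        rw [hκ, mul_add, mul_smul_comm, mul_one, ← mul_assoc, ← pow_succ, hpp, hg,
          Algebra.smul_def (p : S), map_natCast, mul_assoc]
      have h4 := linearMap_mem_of_mem_map (topCoeff p S) hβ
      rw [h3, map_add, map_smul, map_smul, topCoeff_unif, smul_eq_mul, smul_eq_mul, mul_one] at h4
      exact (Ideal.add_mem_iff_left _ (Ideal.mul_mem_right _ _ hpS)).1 h4
    obtain ⟨q, hq⟩ := exists_one_add_pow_prime_eq p Fact.out γ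
    set κ := c • (1 : CycRing p S) + unif p S * d with hκdef
    have h3 : ∃ y, γ ^ p = p * γ * (κ * y) := by
      refine ⟨g * (unif p S ^ (p - 2) * κ) ^ (p - 3) * unif p S ^ (p - 3) * κ, ?_⟩
      have h5 : γ ^ p = γ * γ ^ (p - 3) * γ ^ 2 := by
        rw [← pow_succ', ← pow_add]; congr 1; omega
      have h6 : γ ^ 2 = unif p S ^ (p - 1) * unif p S ^ (p - 3) * κ * κ := by
        rw [hκ, mul_pow, ← pow_mul, ← pow_add, mul_assoc, ← sq]
        congr 2; omega
      rw [h5, h6, hg, ← hκ]; ring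
    obtain ⟨y, hy⟩ := h3
    rw [h1, hy] at hq
    have hu : IsUnit (1 + κ * (unif p S ^ (p - 2) * q + y)) := isUnit_one_add_mul hpS hc d _
    rw [← hu.mul_left_inj, zero_mul]
    linear_combination -hq - p * γ * q * hκ
  -- Second pass, with `J` the annihilator of `p`: now `d` is killed by `p`, so the error term
  -- `π^(p-1)d = pgd` vanishes.
  let J : Ideal S := LinearMap.ker (LinearMap.mulLeft S (p : S))
  have hJ : ∀ s, s ∈ J ↔ (p : S) * s = 0 := fun s => by simp [J]
  have hγJ : γ ∈ J.map (algebraMap S (CycRing p S)) := by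
    rw [← (basis p S).sum_repr γ]
    refine Ideal.sum_mem _ fun i _ => ?_
    rw [Algebra.smul_def]
    refine Ideal.mul_mem_right _ _ (Ideal.mem_map_of_mem _ ((hJ _).2 ?_))
    have h3 : (p : S) • γ = 0 := by rw [Algebra.smul_def, map_natCast, hpγ]
    simpa using congrArg (fun b => (basis p S).repr b i) h3
  obtain ⟨κ, hκ, hγκ⟩ := exists_eq_unif_pow_mul hp hS J h1 h2 hγJ
  obtain ⟨c, hc, d, hd, rfl⟩ := exists_eq_smul_one_add_of_mem hκ
  have hpd : (p : CycRing p S) * d = 0 := by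
    have h3 : J.map (algebraMap S (CycRing p S)) ≤
        LinearMap.ker (LinearMap.mulLeft (CycRing p S) (p : CycRing p S)) := by
      rw [Ideal.map_le_iff_le_comap]
      intro s hs
      have := congrArg (algebraMap S (CycRing p S)) ((hJ s).1 hs)
      rw [map_mul, map_natCast, map_zero] at this
      simpa using this
    simpa using h3 hd
  have hγc : γ = c • unif p S ^ (p - 2) := by
    rw [hγκ, mul_add, ← mul_assoc, ← pow_succ, hpp, hg, mul_smul_comm, mul_one]
    linear_combination g * hpd
  refine ⟨c, ?_, (hJ c).1 hc, by rw [hγc]⟩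
  have h4 := linearMap_mem_of_mem_map (topCoeff p S) hβ
  rwa [hγc, map_smul, topCoeff_unif, smul_eq_mul, mul_one] at h4

end Local
end CycRing

/-! ### The standard representations `stdRep` and their base change. -/

namespace CycRing

open Polynomial

section Std

variable {p : ℕ} [Fact p.Prime] {S : Type*} [CommRing S]

lemma smul_unif_pow_eq_zero {r : S} (hr : (p : S) * r = 0) {n : ℕ} (hn : p - 1 ≤ n) :
    r • unif p S ^ n = 0 := by
  obtain ⟨g, hg⟩ := exists_unif_pow_eq p S
  obtain ⟨k, rfl⟩ := Nat.exists_eq_add_of_le hn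
  have h := congrArg (algebraMap S (CycRing p S)) hr
  rw [map_mul, map_natCast, map_zero] at h
  rw [Algebra.smul_def, pow_add, hg]
  linear_combination g * unif p S ^ k * h

/-- The unit `1 + r (ζ - 1) ^ (p - 2)`. -/
noncomputable def socleUnit (p : ℕ) (r : S) : CycRing p S := 1 + r • unif p S ^ (p - 2)

/-- The perturbation `rπ^(p-2)` has square zero: `2(p - 2) ≥ p - 1` for `p ≥ 3`, and `r` kills
`π^(p-1)`. -/
lemma socleUnit_pow (hp : 3 ≤ p) {r : S} (hr : (p : S) * r = 0) (n : ℕ) :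
    socleUnit p r ^ n = 1 + (n * r) • unif p S ^ (p - 2) := by
  have hsq : (r • unif p S ^ (p - 2)) * (r • unif p S ^ (p - 2)) = 0 := by
    rw [mul_smul_comm, smul_mul_assoc, ← pow_add, smul_unif_pow_eq_zero hr (by omega), smul_zero]
  induction n with
  | zero => simp
  | succ n ih =>
    rw [pow_succ, ih, socleUnit, mul_smul]
    simp only [Algebra.smul_def, map_mul, map_natCast, Nat.cast_succ, map_add, map_one] at hsq ⊢
    linear_combination (n : CycRing p S) * hsq

lemma socleUnit_pow_prime (hp : 3 ≤ p) {r : S} (hr : (p : S) * r = 0) :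
    socleUnit p r ^ p = 1 := by
  rw [socleUnit_pow hp hr, hr, zero_smul, add_zero]

lemma natCast_mul_eq_of_zmod {r : S} (hr : (p : S) * r = 0) {m n : ℕ}
    (h : (m : ZMod p) = n) : (m : S) * r = n * r := by
  rw [ZMod.natCast_eq_natCast_iff, Nat.modEq_iff_dvd] at h
  obtain ⟨k, hk⟩ := h
  have hk' := congrArg (Int.cast : ℤ → S) hk
  push_cast at hk'
  linear_combination -(r * hk') + (-k : S) * hr

/-- `σ_a` scales `π^(p-2)` by `a^(p-2) = a⁻¹` up to multiples of `π^(p-1)`, which `r` kills. This is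
why the exponent is `p - 2`. -/
lemma galois_socleUnit (hp : 3 ≤ p) {r : S} (hr : (p : S) * r = 0) (a : (ZMod p)ˣ) :
    galois p S a (socleUnit p r) = socleUnit p r ^ ((a⁻¹ : (ZMod p)ˣ) : ZMod p).val := by
  obtain ⟨c, hc⟩ := exists_galois_unif (S := S) a
  have hpp : p - 2 + 1 = p - 1 := by omega
  have h0 : r • (unif p S ^ (p - 2) * unif p S) = 0 := by
    rw [← pow_succ, smul_unif_pow_eq_zero hr (by omega)]
  obtain ⟨q, hq⟩ : unif p S ∣ (((a : ZMod p).val : CycRing p S) + unif p S * c) ^ (p - 2) -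
      ((a : ZMod p).val : CycRing p S) ^ (p - 2) :=
    (Dvd.intro c (by ring)).trans (sub_dvd_pow_sub_pow _ _ _)
  have h1 : (((a : ZMod p).val ^ (p - 2) : ℕ) : S) * r =
      (((a⁻¹ : (ZMod p)ˣ) : ZMod p).val : ℕ) * r := by
    apply natCast_mul_eq_of_zmod hr
    have h2 : a ^ (p - 2) = a⁻¹ := by
      rw [eq_inv_iff_mul_eq_one, ← pow_succ, hpp, ZMod.units_pow_card_sub_one_eq_one]
    rw [Nat.cast_pow, ZMod.natCast_zmod_val, ZMod.natCast_zmod_val, ← h2, Units.val_pow_eq_pow_val]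
  rw [socleUnit_pow hp hr, ← h1, socleUnit, map_add, map_one, map_smul, map_pow, hc, mul_pow,
    sub_eq_iff_eq_add.1 hq]
  simp only [Algebra.smul_def, map_mul, Nat.cast_pow] at h0 ⊢
  rw [map_pow, map_natCast]
  linear_combination q * h0

/-- The representation of `DiagGroup p` on `S[ζ]` in which `(u, v)` acts as multiplication by
`ζ ^ u (1 + r (ζ - 1) ^ (p - 2)) ^ v` and `(ZMod p)ˣ` acts as the Galois group. -/
noncomputable def stdRep (hp : 3 ≤ p) (r : S) (hr : (p : S) * r = 0) :
    Representation S (DiagGroup p) (CycRing p S) where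
  toFun g := (LinearMap.mulLeft S (zeta p S ^ (Multiplicative.toAdd g.left).1.val *
    socleUnit p r ^ (Multiplicative.toAdd g.left).2.val)).comp (galois p S g.right).toLinearMap
  map_one' := by
    ext b
    simp [galois_one]
  map_mul' g h := by
    refine LinearMap.ext fun b => ?_
    have h1 : (Multiplicative.toAdd (g * h).left).1 = (Multiplicative.toAdd g.left).1 +
        g.right * (Multiplicative.toAdd h.left).1 := by
      rw [SemidirectProduct.mul_left]; rfl
    have h2 : (Multiplicative.toAdd (g * h).left).2 = (Multiplicative.toAdd g.left).2 +
        ((g.right⁻¹ : (ZMod p)ˣ) : ZMod p) * (Multiplicative.toAdd h.left).2 := by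
      rw [SemidirectProduct.mul_left]; rfl
    have hs := socleUnit_pow_prime hp hr
    simp only [LinearMap.comp_apply, LinearMap.mulLeft_apply, AlgHom.toLinearMap_apply, h1, h2,
      pow_val_add (zeta_pow p S), pow_val_add hs, pow_val_mul (zeta_pow p S), pow_val_mul hs,
      SemidirectProduct.mul_right, galois_mul, Module.End.mul_apply, map_mul, map_pow, galois_zeta,
      galois_socleUnit hp hr]
    ring

lemma stdRep_apply (hp : 3 ≤ p) (r : S) (hr : (p : S) * r = 0) (g : DiagGroup p)
    (b : CycRing p S) : stdRep hp r hr g b = zeta p S ^ (Multiplicative.toAdd g.left).1.val *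
    socleUnit p r ^ (Multiplicative.toAdd g.left).2.val * galois p S g.right b := rfl

end Std

section BaseChange

variable {p : ℕ} {R S : Type*} [CommRing R] [CommRing S]

/-- The ring homomorphism `R[ζ] → S[ζ]` induced by `R → S`. -/
noncomputable def mapHom (p : ℕ) (α : R →+* S) : CycRing p R →+* CycRing p S :=
  AdjoinRoot.map α (cyclotomic p R) (cyclotomic p S) (by rw [map_cyclotomic])

@[simp] lemma mapHom_zeta (α : R →+* S) : mapHom p α (zeta p R) = zeta p S := by
  simp [mapHom]

@[simp] lemma mapHom_unif (α : R →+* S) : mapHom p α (unif p R) = unif p S := by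
  simp [unif]

lemma mapHom_smul (α : R →+* S) (r : R) (b : CycRing p R) :
    mapHom p α (r • b) = α r • mapHom p α b := by
  simp [Algebra.smul_def, mapHom]

lemma mapHom_surjective (α : R →+* S) (h : Function.Surjective α) :
    Function.Surjective (mapHom p α) := by
  intro b
  induction b using AdjoinRoot.induction_on with | ih f =>
  obtain ⟨f, rfl⟩ := map_surjective α h f
  refine ⟨AdjoinRoot.mk _ f, ?_⟩
  rw [mapHom, AdjoinRoot.map, AdjoinRoot.lift_mk, ← AdjoinRoot.aeval_eq, aeval_def, eval₂_map]
  rfl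

lemma mapHom_socleUnit (α : R →+* S) (r : R) :
    mapHom p α (socleUnit p r) = socleUnit p (α r) := by
  simp [socleUnit, mapHom_smul]

variable [Fact p.Prime]

lemma mapHom_galois (α : R →+* S) (a : (ZMod p)ˣ) (b : CycRing p R) :
    mapHom p α (galois p R a b) = galois p S a (mapHom p α b) := by
  have : (mapHom p α).comp (galois p R a : CycRing p R →+* CycRing p R) =
      (galois p S a : CycRing p S →+* CycRing p S).comp (mapHom p α) := by
    apply AdjoinRoot.ringHom_ext
    · ext r
      have h1 := mapHom_smul (p := p) α r 1
      have h2 := mapHom_smul (p := p) α r (galois p R a 1)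
      simp only [map_one, Algebra.smul_def, mul_one] at h1 h2
      simp only [RingHom.comp_apply, RingHom.coe_coe, ← AdjoinRoot.algebraMap_eq,
        AlgHom.commutes, h1]
    · simp
  exact congrArg (fun f => f b) this

lemma mapHom_stdRep (hp : 3 ≤ p) (α : R →+* S) (r : R) (hr : (p : R) * r = 0) {s : S}
    (hs : (p : S) * s = 0) (h : α r = s) (g : DiagGroup p) (b : CycRing p R) :
    mapHom p α (stdRep hp r hr g b) = stdRep hp s hs g (mapHom p α b) := by
  simp [stdRep_apply, mapHom_galois, mapHom_socleUnit, h]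

variable [Algebra R S] [Nontrivial R] [Nontrivial S]

/-- Base change of `R[ζ]`. -/
noncomputable def baseChangeEquiv (p : ℕ) [Fact p.Prime] (R S : Type*) [CommRing R] [CommRing S]
    [Algebra R S] [Nontrivial R] [Nontrivial S] : S ⊗[R] CycRing p R ≃ₗ[S] CycRing p S :=
  ((basis p R).baseChange S).equiv (basis p S) (Equiv.refl _)

lemma baseChangeEquiv_tmul (s : S) (b : CycRing p R) :
    baseChangeEquiv p R S (s ⊗ₜ b) = s • mapHom p (algebraMap R S) b := by
  have h1 : s ⊗ₜ[R] b = s • ((1 : S) ⊗ₜ[R] b) := by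
    rw [TensorProduct.smul_tmul', smul_eq_mul, mul_one]
  rw [h1, map_smul]
  congr 1
  rw [← (basis p R).sum_repr b, TensorProduct.tmul_sum, map_sum, map_sum]
  refine Finset.sum_congr rfl fun i _ => ?_
  rw [mapHom_smul, TensorProduct.tmul_smul, ← algebraMap_smul S, map_smul,
    ← Module.Basis.baseChange_apply S (basis p R), baseChangeEquiv, Module.Basis.equiv_apply]
  simp

end BaseChange

section Lift

variable {p : ℕ} [Fact p.Prime] {k : Type*} [Field k]

/-- The representation `stdRep` over `R`, as a lift of its reduction. -/
noncomputable def stdLift (hp : 3 ≤ p) {R : Type u} [CommRing R] [Nontrivial R] [Algebra R k]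
    (r : R) (hr : (p : R) * r = 0) (h : algebraMap R k r = 0) :
    DefLift.{u} (stdRep hp (0 : k) (mul_zero _)) R where
  M := CycRing p R
  rep := stdRep hp r hr
  φ := baseChangeEquiv p R k
  equivariant g c m := by
    rw [baseChangeEquiv_tmul, baseChangeEquiv_tmul,
      mapHom_stdRep hp (algebraMap R k) r hr (mul_zero _) h, map_smul]

end Lift

end CycRing

/-! ### Rigidity of the action of `x`. -/

/-- If `X ^ p = 1`, the automorphism `A` conjugates `X` to `X ^ 2`, and `e` is an `A`-fixed vector
such that `e, X e, …, X ^ (p - 2) e` is a basis, then `∑ X ^ i e = 0`. -/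
lemma sum_pow_apply_eq_zero {p : ℕ} [Fact p.Prime] (hp : 3 ≤ p) {S M : Type*} [CommRing S]
    [AddCommGroup M] [Module S M] (X A : Module.End S M) (hX : X ^ p = 1) (hA : A * X = X ^ 2 * A)
    (e : M) (he : A e = e)
    (hli : LinearIndependent S (fun i : Fin (p - 1) => (X ^ (i : ℕ)) e))
    (hsp : Submodule.span S (Set.range (fun i : Fin (p - 1) => (X ^ (i : ℕ)) e)) = ⊤) :
    ∑ i ∈ Finset.range p, (X ^ i) e = 0 := by
  -- Relations among all `p` vectors `X^i e` are the kernel of `T`. By the basis hypothesis a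
  -- relation is determined by its coefficient at `-1 = p - 1`, so the kernel is free on one
  -- relation `v`, and any operation preserving the kernel scales `v`.
  let T : (ZMod p → S) → M := fun c => ∑ i, c i • (X ^ i.val) e
  have h2 : (2 : ZMod p) ≠ 0 := by exact_mod_cast ZMod.natCast_two_ne_zero hp
  have hpred : ((p - 1 : ℕ) : ZMod p) = -1 := by
    rw [Nat.cast_sub (by omega)]; simp
  have hsplit : ∀ c, T c = ∑ i : Fin (p - 1), c ((i : ℕ) : ZMod p) • (X ^ (i : ℕ)) e +
      c (-1) • (X ^ (p - 1)) e := by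
    intro c
    have h := ZMod.sum_val p (fun i => c (i : ZMod p) • (X ^ i) e)
    simp only [ZMod.natCast_zmod_val] at h
    simp only [T]
    have h' := Finset.sum_range_succ (fun i => c (i : ZMod p) • (X ^ i) e) (p - 1)
    rw [Nat.sub_add_cancel (by omega), hpred] at h'
    rw [h, h', Finset.sum_range]
  have hshift : ∀ c, T (fun i => c (i - 1)) = X (T c) := by
    intro c
    simp only [T, map_sum, map_smul]
    rw [← Equiv.sum_comp (Equiv.addRight (1 : ZMod p))]
    refine Finset.sum_congr rfl fun i _ => ?_
    have : Fact (1 < p) := ⟨by omega⟩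
    simp [pow_val_add hX, ZMod.val_one, ← pow_succ', ← Module.End.mul_apply, pow_succ]
  have hcomm : ∀ n : ℕ, A ((X ^ n) e) = (X ^ (2 * n)) e := by
    intro n
    induction n with
    | zero => simpa using he
    | succ n ih =>
      rw [pow_succ', Module.End.mul_apply, ← Module.End.mul_apply, hA, Module.End.mul_apply, ih,
        ← Module.End.mul_apply, ← pow_add]
      congr 2; ring
  have hdouble : ∀ c, T (fun i => c (i * 2⁻¹)) = A (T c) := by
    intro c
    simp only [T, map_sum, map_smul, hcomm]
    rw [← Equiv.sum_comp (Equiv.mulRight₀ (2 : ZMod p) h2)]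
    refine Finset.sum_congr rfl fun i _ => ?_
    have h3 : X ^ (2 * i.val) = X ^ (i * 2).val := by
      rw [mul_comm, ← pow_val_natCast hX]
      congr 2
      simp
    simp [h3, mul_inv_cancel_right₀ h2]
  have hlin : ∀ (s : S) c c', T (fun i => c i - s * c' i) = T c - s • T c' := by
    intro s c c'
    simp only [T, sub_smul, Finset.sum_sub_distrib, Finset.smul_sum, mul_smul]
  have huniq : ∀ c, T c = 0 → c (-1) = 0 → ∀ i, c i = 0 := by
    intro c hc h1 i
    rw [hsplit, h1, zero_smul, add_zero] at hc
    by_cases hi : i.val < p - 1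
    · have := Fintype.linearIndependent_iff.1 hli _ hc ⟨i.val, hi⟩
      simpa using this
    · have h2 : i.val = p - 1 := by have := i.val_lt; omega
      rw [← ZMod.natCast_zmod_val i, h2, hpred, h1]
  have hprop : ∀ v, T v = 0 → v (-1) = 1 → ∀ c, T c = 0 → ∀ i, c i = c (-1) * v i := by
    intro v hv hv1 c hc i
    have := huniq (fun i => c i - c (-1) * v i) (by rw [hlin, hc, hv]; simp) (by simp [hv1]) i
    exact sub_eq_zero.1 this
  obtain ⟨v, hv, hv1⟩ : ∃ v, T v = 0 ∧ v (-1) = 1 := by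
    have h : (X ^ (p - 1)) e ∈ Submodule.span S
        (Set.range (fun i : Fin (p - 1) => (X ^ (i : ℕ)) e)) := hsp ▸ Submodule.mem_top
    obtain ⟨d, hd⟩ := (Submodule.mem_span_range_iff_exists_fun S).1 h
    have hp1 : (-1 : ZMod p).val = p - 1 := by
      rw [← hpred]; exact ZMod.val_natCast_of_lt (by omega)
    refine ⟨fun i => if h : i.val < p - 1 then -d ⟨i.val, h⟩ else 1, ?_, by simp [hp1]⟩
    rw [hsplit, ← hd]
    simp only [hp1, lt_irrefl, dite_false, one_smul]
    rw [← Finset.sum_add_distrib]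
    refine Finset.sum_eq_zero fun i _ => ?_
    have hi : ((i : ℕ) : ZMod p).val = i := ZMod.val_natCast_of_lt (by omega)
    simp [hi]
  set l := v (-1 - 1) with hl
  have hvs : ∀ i, v (i - 1) = l * v i :=
    hprop v hv hv1 (fun i => v (i - 1)) (by rw [hshift, hv, map_zero])
  set m := v (-1 * 2⁻¹) with hm
  have hvd : ∀ i, v (i * 2⁻¹) = m * v i :=
    hprop v hv hv1 (fun i => v (i * 2⁻¹)) (by rw [hdouble, hv, map_zero])
  -- Shifting by two and then halving is halving and then shifting by one: comparing the positions
  -- `-4` and `-2` gives `l = l²`.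
  have hl2 : l = l ^ 2 := by
    have h3 := hvd (-2 - 1 - 1)
    rw [hvs, hvs, show (-2 - 1 - 1 : ZMod p) * 2⁻¹ = -2 * 2⁻¹ - 1 by field_simp; ring, hvs,
      show (-2 : ZMod p) * 2⁻¹ = -1 by field_simp, hv1] at h3
    have h4 := hvd (-2)
    rw [show (-2 : ZMod p) * 2⁻¹ = -1 by field_simp, hv1] at h4
    linear_combination h3 - l ^ 2 * h4
  have hpow : ∀ n : ℕ, v (-1 - n) = l ^ n := by
    intro n
    induction n with
    | zero => simpa using hv1
    | succ n ih => rw [Nat.cast_succ, ← sub_sub, hvs, ih, pow_succ']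
  -- A shift by `p` is the identity, so `l` is a unit, and an idempotent unit is `1`.
  have hl1 : l = 1 := by
    have h3 : l * l ^ (p - 1) = 1 := by
      rw [← pow_succ', Nat.sub_add_cancel (by omega), ← hpow]; simpa using hv1
    calc l = l * (l * l ^ (p - 1)) := by rw [h3, mul_one]
      _ = l ^ 2 * l ^ (p - 1) := by ring
      _ = 1 := by rw [← hl2, h3]
  have hone : ∀ i, v i = 1 := by
    intro i
    have h3 := hpow (-1 - i).val
    rwa [ZMod.natCast_zmod_val, sub_sub_cancel, hl1, one_pow] at h3
  rw [← ZMod.sum_val p (fun i => (X ^ i) e), ← hv]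
  simp [T, hone]

/-- Elements killed by `k ⊗ -` lie in the maximal ideal times the module. -/
lemma mem_smul_top_of_one_tmul_eq_zero {S k M : Type*} [CommRing S] [Field k] [Algebra S k]
    [AddCommGroup M] [Module S M] [Module.Free S M] [Module.Finite S M] {m : M}
    (h : (1 : k) ⊗ₜ[S] m = 0) : m ∈ (RingHom.ker (algebraMap S k) • ⊤ : Submodule S M) := by
  let b := Module.Free.chooseBasis S M
  rw [← b.sum_repr m]
  refine Submodule.sum_mem _ fun i _ => Submodule.smul_mem_smul ?_ Submodule.mem_top
  have h1 := congrArg (fun x => (b.baseChange k).repr x i) h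
  simpa [Algebra.smul_def] using h1

/-! ### Coefficient rings, and generators of the group. -/

section Coefficient

variable {k S : Type*} [Field k] [CommRing S] [Algebra S k] [IsCoefficientRing k S]

lemma IsCoefficientRing.ker_algebraMap :
    RingHom.ker (algebraMap S k) = IsLocalRing.maximalIdeal S :=
  IsLocalRing.eq_maximalIdeal
    (RingHom.ker_isMaximal_of_surjective _ IsCoefficientRing.residue_surjective)

lemma IsCoefficientRing.mem_maximalIdeal {s : S} :
    s ∈ IsLocalRing.maximalIdeal S ↔ algebraMap S k s = 0 := by
  rw [← ker_algebraMap (k := k), RingHom.mem_ker]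

lemma IsCoefficientRing.isUnit_iff {s : S} : IsUnit s ↔ algebraMap S k s ≠ 0 := by
  rw [Ne, ← mem_maximalIdeal, IsLocalRing.mem_maximalIdeal, mem_nonunits_iff, not_not]

end Coefficient

namespace DiagGroup

variable (p : ℕ)

/-- The element `((1, 0), 1)`. -/
def x : DiagGroup p := SemidirectProduct.inl (Multiplicative.ofAdd (1, 0))

/-- The element `((0, 1), 1)`. -/
def y : DiagGroup p := SemidirectProduct.inl (Multiplicative.ofAdd (0, 1))

variable {p}

lemma x_pow (n : ℕ) : x p ^ n = SemidirectProduct.inl (Multiplicative.ofAdd ((n : ZMod p), 0)) := by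
  rw [x, ← map_pow, ← ofAdd_nsmul]
  simp

lemma y_pow (n : ℕ) : y p ^ n = SemidirectProduct.inl (Multiplicative.ofAdd (0, (n : ZMod p))) := by
  rw [y, ← map_pow, ← ofAdd_nsmul]
  simp

lemma x_pow_self : x p ^ p = 1 := by
  rw [x_pow, ZMod.natCast_self]; rfl

lemma y_pow_self : y p ^ p = 1 := by
  rw [y_pow, ZMod.natCast_self]; rfl

lemma x_mul_y : x p * y p = y p * x p := by
  rw [x, y, ← map_mul SemidirectProduct.inl, ← map_mul SemidirectProduct.inl, mul_comm]

variable [Fact p.Prime]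

lemma inr_mul_x (a : (ZMod p)ˣ) : (SemidirectProduct.inr a : DiagGroup p) * x p =
    x p ^ (a : ZMod p).val * SemidirectProduct.inr a := by
  rw [x_pow, x, ZMod.natCast_zmod_val]
  refine SemidirectProduct.ext ?_ (by simp only [SemidirectProduct.mul_right,
    SemidirectProduct.right_inl, SemidirectProduct.right_inr, one_mul, mul_one])
  simp only [SemidirectProduct.mul_left, SemidirectProduct.left_inr, SemidirectProduct.right_inr,
    SemidirectProduct.left_inl, SemidirectProduct.right_inl, one_mul, map_one, mul_one]
  change Multiplicative.ofAdd ((a : ZMod p) * 1, ((a⁻¹ : (ZMod p)ˣ) : ZMod p) * 0) = _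
  rw [mul_one, mul_zero]

lemma inr_mul_y (a : (ZMod p)ˣ) : (SemidirectProduct.inr a : DiagGroup p) * y p =
    y p ^ ((a⁻¹ : (ZMod p)ˣ) : ZMod p).val * SemidirectProduct.inr a := by
  rw [y_pow, y, ZMod.natCast_zmod_val]
  refine SemidirectProduct.ext ?_ (by simp only [SemidirectProduct.mul_right,
    SemidirectProduct.right_inl, SemidirectProduct.right_inr, one_mul, mul_one])
  simp only [SemidirectProduct.mul_left, SemidirectProduct.left_inr, SemidirectProduct.right_inr,
    SemidirectProduct.left_inl, SemidirectProduct.right_inl, one_mul, map_one, mul_one]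
  change Multiplicative.ofAdd ((a : ZMod p) * 0, ((a⁻¹ : (ZMod p)ˣ) : ZMod p) * 1) = _
  rw [mul_one, mul_zero]

lemma eq_mul (g : DiagGroup p) : g = x p ^ (Multiplicative.toAdd g.left).1.val *
    y p ^ (Multiplicative.toAdd g.left).2.val * SemidirectProduct.inr g.right := by
  rw [x_pow, y_pow, ← map_mul, ZMod.natCast_zmod_val, ZMod.natCast_zmod_val, ← ofAdd_add]
  conv_lhs => rw [← SemidirectProduct.inl_left_mul_inr_right g]
  congr 2
  apply Multiplicative.toAdd.injective
  simp

end DiagGroup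

/-! ### The structure of an arbitrary lift. -/

namespace CycRing

open Polynomial

section

variable {p : ℕ} [Fact p.Prime] {S : Type*} [CommRing S] (hp : 3 ≤ p) {r : S} (hr : (p : S) * r = 0)

lemma stdRep_inr (a : (ZMod p)ˣ) (b : CycRing p S) :
    stdRep hp r hr (SemidirectProduct.inr a) b = galois p S a b := by
  simp [stdRep_apply]

lemma stdRep_x (b : CycRing p S) : stdRep hp r hr (DiagGroup.x p) b = zeta p S * b := by
  have : Fact (1 < p) := ⟨by omega⟩
  simp [stdRep_apply, DiagGroup.x, galois_one, ZMod.val_one]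

lemma stdRep_y (b : CycRing p S) : stdRep hp r hr (DiagGroup.y p) b = socleUnit p r * b := by
  have : Fact (1 < p) := ⟨by omega⟩
  simp [stdRep_apply, DiagGroup.y, galois_one, ZMod.val_one]

end

section Eval

variable {p : ℕ} {S M : Type*} [CommRing S] [AddCommGroup M] [Module S M]

/-- The linear map `S[ζ] → M` sending `f(ζ)` to `f(X) e`, for `f` of degree less than `p - 1`. -/
noncomputable def evalMap (p : ℕ) (X : Module.End S M) (e : M) : CycRing p S →ₗ[S] M :=
  ((LinearMap.applyₗ e).comp (aeval X).toLinearMap).comp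
    (AdjoinRoot.modByMonicHom (cyclotomic.monic p S))

lemma evalMap_mk (X : Module.End S M) (e : M) (f : S[X]) :
    evalMap p X e (AdjoinRoot.mk _ f) = aeval X (f %ₘ cyclotomic p S) e := by
  simp [evalMap]

variable [Fact p.Prime]

lemma evalMap_zeta_pow [Nontrivial S] (X : Module.End S M) (e : M) {n : ℕ} (hn : n < p - 1) :
    evalMap p X e (zeta p S ^ n) = (X ^ n) e := by
  rw [zeta, ← AdjoinRoot.mk_X, ← map_pow, evalMap_mk,
    (modByMonic_eq_self_iff (cyclotomic.monic p S)).2]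
  · simp
  · rw [degree_X_pow, degree_eq_natDegree (cyclotomic.monic p S).ne_zero,
      natDegree_cyclotomic_prime]
    exact_mod_cast hn

/-- When `Φ(X)` kills `e`, `f(X)e` depends only on `f` modulo `Φ`, so `evalMap` turns multiplication
by `f(ζ)` into `f(X)`. -/
lemma evalMap_mk_mul (X : Module.End S M) (e : M)
    (h : ∑ i ∈ Finset.range p, (X ^ i) e = 0) (f : S[X])
    (b : CycRing p S) :
    evalMap p X e (AdjoinRoot.mk _ f * b) = aeval X f (evalMap p X e b) := by
  have key : ∀ g : S[X], evalMap p X e (AdjoinRoot.mk _ g) = aeval X g e := by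
    intro g
    have h1 : aeval X (cyclotomic p S) e = 0 := by
      rw [cyclotomic_prime S p]
      simpa using h
    have h2 := congrArg (fun g => aeval X g e) (modByMonic_add_div g (cyclotomic p S))
    simp only [map_add, LinearMap.add_apply, mul_comm (cyclotomic p S), map_mul,
      Module.End.mul_apply, h1, map_zero, add_zero] at h2
    rw [evalMap_mk, h2]
  induction b using AdjoinRoot.induction_on with | ih g =>
  rw [← map_mul, key, key, map_mul, Module.End.mul_apply]

end Eval

section Structure

variable {p : ℕ} [Fact p.Prime] {S : Type u} [CommRing S] [Algebra S (ZMod p)]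
  [IsCoefficientRing (ZMod p) S]
  {hp : 3 ≤ p} (L : DefLift.{v} (stdRep hp (0 : ZMod p) (mul_zero _)) S)

/-- Average any lift of `1 ∈ V` over `F_p^*`, whose order `p - 1` reduces to `-1` and so is a unit
in `S`. -/
lemma exists_fixed_lift_one : ∃ e : L.M,
    (∀ a : (ZMod p)ˣ, L.rep (SemidirectProduct.inr a) e = e) ∧ L.φ ((1 : ZMod p) ⊗ₜ[S] e) = 1 := by
  obtain ⟨m, hm⟩ := TensorProduct.mk_surjective S L.M (ZMod p)
    (IsCoefficientRing.residue_surjective) (L.φ.symm 1)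
  have hm' : L.φ ((1 : ZMod p) ⊗ₜ[S] m) = 1 := by
    rw [← LinearEquiv.eq_symm_apply, ← hm]; rfl
  have hcard : ((p - 1 : ℕ) : ZMod p) = -1 := by
    rw [Nat.cast_sub (by omega)]; simp
  obtain ⟨w, hw⟩ : IsUnit ((p - 1 : ℕ) : S) := by
    rw [IsCoefficientRing.isUnit_iff (k := ZMod p), map_natCast, hcard]
    simp
  refine ⟨((w⁻¹ : Sˣ) : S) • ∑ a : (ZMod p)ˣ, L.rep (SemidirectProduct.inr a) m, ?_, ?_⟩
  · intro a
    rw [map_smul, map_sum]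
    congr 1
    conv_rhs => rw [← Equiv.sum_comp (Equiv.mulLeft a)]
    refine Finset.sum_congr rfl fun b _ => ?_
    simp
  · have h1 : L.φ ((1 : ZMod p) ⊗ₜ[S] ∑ a : (ZMod p)ˣ, L.rep (SemidirectProduct.inr a) m) =
        ((p - 1 : ℕ) : ZMod p) • 1 := by
      rw [TensorProduct.tmul_sum, map_sum]
      simp only [L.equivariant, hm', stdRep_inr, map_one]
      rw [Finset.sum_const, Finset.card_univ, ZMod.card_units, Nat.cast_smul_eq_nsmul]
    rw [TensorProduct.tmul_smul, ← algebraMap_smul (ZMod p), map_smul, h1, smul_smul,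
      ← map_natCast (algebraMap S (ZMod p)), ← hw, ← map_mul]
    simp

lemma φ_evalMap {e : L.M} (heφ : L.φ ((1 : ZMod p) ⊗ₜ[S] e) = 1)
    (b : CycRing p S) :
    L.φ ((1 : ZMod p) ⊗ₜ[S] evalMap p (L.rep (DiagGroup.x p)) e b) =
      mapHom p (algebraMap S (ZMod p)) b := by
  rw [← (basis p S).sum_repr b, map_sum, map_sum, TensorProduct.tmul_sum, map_sum]
  refine Finset.sum_congr rfl fun i _ => ?_
  rw [map_smul, mapHom_smul, TensorProduct.tmul_smul, ← algebraMap_smul (ZMod p), map_smul,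
    basis_apply, evalMap_zeta_pow _ _ i.2, map_pow, mapHom_zeta]
  congr 1
  have h : ∀ n : ℕ, L.φ ((1 : ZMod p) ⊗ₜ[S] ((L.rep (DiagGroup.x p) ^ n) e)) =
      zeta p (ZMod p) ^ n := by
    intro n
    induction n with
    | zero => simpa using heφ
    | succ n ih => rw [pow_succ', Module.End.mul_apply, L.equivariant, ih, stdRep_x, pow_succ']
  exact h i

/-- Nakayama gives surjectivity, since the reduction is the identification with `V`. Both sides are
free of rank `p - 1`, and a surjective endomorphism of a finite module is injective. -/
lemma evalMap_bijective {e : L.M} (heφ : L.φ ((1 : ZMod p) ⊗ₜ[S] e) = 1) :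
    Function.Bijective (evalMap p (L.rep (DiagGroup.x p)) e) := by
  set F := evalMap p (L.rep (DiagGroup.x p)) e
  have hsurj : Function.Surjective F := by
    rw [← LinearMap.range_eq_top, ← top_le_iff]
    refine Submodule.le_of_le_smul_of_le_jacobson_bot (I := IsLocalRing.maximalIdeal S)
      Module.Finite.fg_top (IsLocalRing.maximalIdeal_le_jacobson _) fun m _ => ?_
    obtain ⟨b, hb⟩ := mapHom_surjective (p := p) (algebraMap S (ZMod p))
      IsCoefficientRing.residue_surjective (L.φ ((1 : ZMod p) ⊗ₜ[S] m))
    rw [← φ_evalMap L heφ] at hb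
    have h1 : (1 : ZMod p) ⊗ₜ[S] (m - F b) = 0 := by
      rw [TensorProduct.tmul_sub, ← L.φ.injective hb, sub_self]
    have h2 := mem_smul_top_of_one_tmul_eq_zero h1
    rw [IsCoefficientRing.ker_algebraMap] at h2
    rw [← add_sub_cancel (F b) m]
    exact Submodule.add_mem_sup ⟨b, rfl⟩ h2
  refine ⟨?_, hsurj⟩
  have h3 : Module.finrank S L.M = p - 1 := by
    rw [← Module.finrank_baseChange (R := ZMod p) (S := S) (M' := L.M), L.φ.finrank_eq, finrank_eq]
  let E := LinearEquiv.ofFinrankEq (R := S) L.M (CycRing p S) (by rw [h3, finrank_eq])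
  have h4 : Function.Injective (E.toLinearMap.comp F) :=
    OrzechProperty.injective_of_surjective_endomorphism _
      (E.surjective.comp hsurj)
  exact Function.Injective.of_comp h4

/-- The rigidity argument applies with `A` the action of `2 ∈ F_p^*`, which fixes `e` and conjugates
`x` to `x²`. -/
lemma sum_x_pow_apply_eq_zero {e : L.M}
    (he : ∀ a : (ZMod p)ˣ, L.rep (SemidirectProduct.inr a) e = e)
    (heφ : L.φ ((1 : ZMod p) ⊗ₜ[S] e) = 1) :
    ∑ i ∈ Finset.range p, (L.rep (DiagGroup.x p) ^ i) e = 0 := by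
  have h20 : ((2 : ℕ) : ZMod p) ≠ 0 := ZMod.natCast_two_ne_zero hp
  have h2 : ((Units.mk0 _ h20 : (ZMod p)ˣ) : ZMod p).val = 2 :=
    ZMod.val_natCast_of_lt (by omega)
  have hb := (evalMap_bijective L heφ)
  have hB : ∀ i : Fin (p - 1), (L.rep (DiagGroup.x p) ^ (i : ℕ)) e =
      (basis p S).map (LinearEquiv.ofBijective _ hb) i := by
    intro i
    simp [evalMap_zeta_pow _ _ i.2]
  refine sum_pow_apply_eq_zero hp (L.rep (DiagGroup.x p))
    (L.rep (SemidirectProduct.inr (Units.mk0 _ h20))) ?_ ?_ e (he _) ?_ ?_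
  · rw [← map_pow, DiagGroup.x_pow_self, map_one]
  · rw [← map_mul, DiagGroup.inr_mul_x, h2, map_mul, map_pow]
  · simp_rw [hB]
    exact Module.Basis.linearIndependent _
  · simp_rw [hB]
    exact Module.Basis.span_eq _

end Structure

end CycRing

namespace CycRing

open Polynomial

section Structure

variable {p : ℕ} [Fact p.Prime] {S : Type u} [CommRing S] [Algebra S (ZMod p)]
  [IsCoefficientRing (ZMod p) S]
  {hp : 3 ≤ p} (L : DefLift.{v} (stdRep hp (0 : ZMod p) (mul_zero _)) S)

lemma mem_map_maximalIdeal_of_mapHom_eq_zero {b : CycRing p S}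
    (hb : mapHom p (algebraMap S (ZMod p)) b = 0) :
    b ∈ (IsLocalRing.maximalIdeal S).map (algebraMap S (CycRing p S)) := by
  have h : (1 : ZMod p) ⊗ₜ[S] b = 0 := by
    apply (baseChangeEquiv p S (ZMod p)).injective
    rw [baseChangeEquiv_tmul, hb, smul_zero, map_zero]
  have h1 := mem_smul_top_of_one_tmul_eq_zero h
  rwa [IsCoefficientRing.ker_algebraMap, Ideal.smul_top_eq_map] at h1

/-- A lift of the standard representation over `F_p` is a standard representation. -/
theorem exists_rep_eq_stdRep {e : L.M}
    (he : ∀ a : (ZMod p)ˣ, L.rep (SemidirectProduct.inr a) e = e)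
    (heφ : L.φ ((1 : ZMod p) ⊗ₜ[S] e) = 1) :
    ∃ r ∈ IsLocalRing.maximalIdeal S, ∃ hr : (p : S) * r = 0, ∀ g b,
      L.rep g (evalMap p (L.rep (DiagGroup.x p)) e b) =
        evalMap p (L.rep (DiagGroup.x p)) e (stdRep hp r hr g b) := by
  set X := L.rep (DiagGroup.x p) with hX
  set F := evalMap p X e with hF
  have hFb : Function.Bijective F := evalMap_bijective L heφ
  have hsum := sum_x_pow_apply_eq_zero L he heφ
  have hF1 : F 1 = e := by
    have := evalMap_zeta_pow (p := p) X e (n := 0) (by omega)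
    simpa using this
  have hmul : ∀ (f : S[X]) b, F (AdjoinRoot.mk _ f * b) = aeval X f (F b) :=
    evalMap_mk_mul X e hsum
  have hzeta : ∀ b, F (zeta p S * b) = X (F b) := by
    intro b
    have := hmul Polynomial.X b
    rwa [AdjoinRoot.mk_X, aeval_X] at this
  -- An endomorphism commuting with `X` is determined by the image of `e`, so under `F` it is
  -- multiplication by one element.
  have hcomm : ∀ Y : Module.End S L.M, Commute Y X → ∀ β, F β = Y e → ∀ b, F (β * b) = Y (F b) := by
    intro Y hY β hβ b
    induction b using AdjoinRoot.induction_on with | ih f =>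
    have h1 := hmul f 1
    rw [mul_one, hF1] at h1
    have h2 : Commute Y (aeval X f) := by
      clear h1
      induction f using Polynomial.induction_on' with
      | add a b ha hb => rw [map_add]; exact ha.add_right hb
      | monomial n s =>
        rw [aeval_monomial]
        exact Commute.mul_right (Algebra.commutes s Y).symm (hY.pow_right n)
    rw [mul_comm, hmul, hβ, h1, ← Module.End.mul_apply, ← Module.End.mul_apply, h2.eq]
  set Y := L.rep (DiagGroup.y p) with hY
  have hXY : Commute Y X := by
    rw [Commute, SemiconjBy, hX, hY, ← map_mul, ← map_mul, DiagGroup.x_mul_y]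
  obtain ⟨β, hβ⟩ := hFb.surjective (Y e)
  have hβn : ∀ n : ℕ, ∀ b, F (β ^ n * b) = (Y ^ n) (F b) := by
    intro n
    induction n with
    | zero => simp
    | succ n ih =>
      intro b
      rw [pow_succ', mul_assoc, hcomm Y hXY β hβ, ih, pow_succ', Module.End.mul_apply]
  have hzn : ∀ n : ℕ, ∀ b, F (zeta p S ^ n * b) = (X ^ n) (F b) := by
    intro n
    induction n with
    | zero => simp
    | succ n ih =>
      intro b
      rw [pow_succ', mul_assoc, hzeta, ih, pow_succ', Module.End.mul_apply]
  have hgal : ∀ (a : (ZMod p)ˣ) b, L.rep (SemidirectProduct.inr a) (F b) =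
      F (galois p S a b) := by
    intro a b
    set A := L.rep (SemidirectProduct.inr a) with hA
    have hAX : A * X = X ^ (a : ZMod p).val * A := by
      rw [hA, hX, ← map_mul, DiagGroup.inr_mul_x, map_mul, map_pow]
    suffices h : A.comp F = F.comp (galois p S a).toLinearMap from congrArg (fun f => f b) h
    refine (basis p S).ext fun i => ?_
    rw [LinearMap.comp_apply, LinearMap.comp_apply, basis_apply]
    generalize (i : ℕ) = n
    induction n with
    | zero => simpa [hF1] using he a
    | succ n ih =>
      rw [pow_succ', hzeta, ← Module.End.mul_apply, hAX, Module.End.mul_apply, ih,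
        AlgHom.toLinearMap_apply, AlgHom.toLinearMap_apply, map_mul, galois_zeta, hzn]
  have hβp : β ^ p = 1 := by
    apply hFb.injective
    have h1 := hβn p 1
    rw [mul_one] at h1
    rw [h1, hY, ← map_pow, DiagGroup.y_pow_self, map_one, Module.End.one_apply]
  have hβgal : ∀ a : (ZMod p)ˣ,
      galois p S a β = β ^ ((a⁻¹ : (ZMod p)ˣ) : ZMod p).val := by
    intro a
    apply hFb.injective
    have h1 := hβn ((a⁻¹ : (ZMod p)ˣ) : ZMod p).val 1
    rw [mul_one, hF1] at h1
    rw [← hgal, hβ, h1, hY, ← Module.End.mul_apply, ← map_mul, DiagGroup.inr_mul_y, map_mul,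
      Module.End.mul_apply, he a, map_pow]
  -- `y` acts trivially on `V`, so `β` reduces to `1`.
  have hβm : β - 1 ∈ (IsLocalRing.maximalIdeal S).map (algebraMap S (CycRing p S)) := by
    apply mem_map_maximalIdeal_of_mapHom_eq_zero
    rw [map_sub, map_one, sub_eq_zero, ← φ_evalMap L heφ, ← hX, ← hF, hβ, hY, L.equivariant, heφ,
      stdRep_y]
    simp [socleUnit]
  have hS : ∀ n : ℤ, (n : ZMod p) ≠ 0 → IsUnit (n : S) := fun n hn => by
    rwa [IsCoefficientRing.isUnit_iff (k := ZMod p), map_intCast]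
  have hpS : (p : S) ∈ IsLocalRing.maximalIdeal S := by
    rw [IsCoefficientRing.mem_maximalIdeal (k := ZMod p), map_natCast, ZMod.natCast_self]
  obtain ⟨r, hrm, hr, rfl⟩ := exists_eq_one_add_smul hp hS hpS hβp hβgal hβm
  refine ⟨r, hrm, hr, fun g b => ?_⟩
  rw [stdRep_apply, mul_assoc, hzn, socleUnit, hβn, ← hgal]
  conv_lhs => rw [DiagGroup.eq_mul g]
  rw [map_mul, map_mul, map_pow, map_pow, Module.End.mul_apply, Module.End.mul_apply]

end Structure

end CycRing

-- Which base changes of a standard lift give a prescribed lift.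

universe w

namespace CycRing

open Polynomial

lemma mapHom_comp {p : ℕ} {R S T : Type*} [CommRing R] [CommRing S] [CommRing T]
    (β : S →+* T) (α : R →+* S) (b : CycRing p R) :
    mapHom p β (mapHom p α b) = mapHom p (β.comp α) b :=
  DFunLike.congr_fun (AdjoinRoot.map_comp_map α β (cyclotomic p R) (cyclotomic p S)
    (cyclotomic p T) (by rw [map_cyclotomic]) (by rw [map_cyclotomic])) b

variable {p : ℕ} [Fact p.Prime] {S : Type u} [CommRing S] [Algebra S (ZMod p)]
  [IsCoefficientRing (ZMod p) S] {R : Type w} [CommRing R] [Nontrivial R] [Algebra R (ZMod p)]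

/-- The base changes of the standard lift over `R` with parameter `t` that are isomorphic to a given
lift `L` are those along which `t` maps to a certain element determined by `L`. -/
theorem exists_arisesFrom_iff (hp : 3 ≤ p) {t : R} (ht : (p : R) * t = 0)
    (ht0 : algebraMap R (ZMod p) t = 0)
    (L : DefLift.{v} (stdRep hp (0 : ZMod p) (mul_zero _)) S) :
    ∃ r ∈ IsLocalRing.maximalIdeal S, (p : S) * r = 0 ∧ ∀ α : R →+* S,
      (algebraMap S (ZMod p)).comp α = algebraMap R (ZMod p) →
        (L.ArisesFrom (stdLift hp t ht ht0) α ↔ α t = r) := by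
  obtain ⟨e₀, he, heφ⟩ := exists_fixed_lift_one L
  obtain ⟨r, hrm, hr, hrep⟩ := exists_rep_eq_stdRep L he heφ
  have hφ := φ_evalMap L heφ
  have hFb := evalMap_bijective L heφ
  set F := evalMap p (L.rep (DiagGroup.x p)) e₀
  refine ⟨r, hrm, hr, fun α hα => ⟨fun h => ?_, fun h => ?_⟩⟩
  · let : Algebra R S := α.toAlgebra
    obtain ⟨E, hE, -⟩ := h
    change S ⊗[R] CycRing p R ≃ₗ[S] L.M at E
    change ∀ g s b, E (s ⊗ₜ[R] stdRep hp t ht g b) = L.rep g (E (s ⊗ₜ[R] b)) at hE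
    -- Compatibility with `x` makes `E` multiplication by `c`; comparing the actions of `y` then
    -- isolates `α t - r`.
    obtain ⟨c, hc⟩ := hFb.surjective (E (1 ⊗ₜ[R] 1))
    have hEF : ∀ b, E (1 ⊗ₜ[R] b) = F (mapHom p α b * c) := by
      have hpow : ∀ n : ℕ, E (1 ⊗ₜ[R] (zeta p R ^ n)) = F (zeta p S ^ n * c) := by
        intro n
        induction n with
        | zero => simp [hc]
        | succ n ih =>
          rw [pow_succ', ← stdRep_x hp ht, hE, ih, hrep, stdRep_x, pow_succ', mul_assoc]
      intro b
      rw [← (basis p R).sum_repr b, TensorProduct.tmul_sum, map_sum, map_sum, Finset.sum_mul,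
        map_sum]
      refine Finset.sum_congr rfl fun i _ => ?_
      rw [mapHom_smul, smul_mul_assoc, map_smul, TensorProduct.tmul_smul, ← algebraMap_smul S,
        map_smul, basis_apply, hpow, map_pow, mapHom_zeta]
      rfl
    have h1 : F (socleUnit p (α t) * c) = F (socleUnit p r * c) := by
      rw [← mapHom_socleUnit, ← hEF, ← stdRep_y hp hr, ← hrep, hc, ← hE, stdRep_y]
      simp
    have h2 : (α t - r) • (unif p S ^ (p - 2) * c) = 0 := by
      have := hFb.injective h1
      simp only [socleUnit, add_mul, one_mul, add_right_inj, smul_mul_assoc] at this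
      rw [sub_smul, this, sub_self]
    -- The factor `c` is cancelled through injectivity of `E`, without showing that `c` is a unit.
    have h3 : (α t - r) ⊗ₜ[R] (unif p R ^ (p - 2)) = 0 := by
      apply E.injective
      have h4 : (α t - r) ⊗ₜ[R] (unif p R ^ (p - 2)) =
          (α t - r) • ((1 : S) ⊗ₜ[R] (unif p R ^ (p - 2))) := by
        rw [TensorProduct.smul_tmul', smul_eq_mul, mul_one]
      rw [h4, map_smul, hEF, map_pow, mapHom_unif, ← map_smul, h2, map_zero, map_zero]
    have h4 := congrArg (baseChangeEquiv p R S) h3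
    rw [baseChangeEquiv_tmul, map_pow, mapHom_unif, map_zero, sub_smul, sub_eq_zero] at h4
    exact smul_unif_injective p S h4
  · let : Algebra R S := α.toAlgebra
    refine ⟨(baseChangeEquiv p R S).trans (LinearEquiv.ofBijective F hFb), ?_, ?_⟩
    · intro g s b
      change CycRing p R at b
      change F (baseChangeEquiv p R S (s ⊗ₜ[R] stdRep hp t ht g b)) =
        L.rep g (F (baseChangeEquiv p R S (s ⊗ₜ[R] b)))
      rw [baseChangeEquiv_tmul, baseChangeEquiv_tmul, map_smul, map_smul, map_smul, hrep]
      congr 2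
      exact mapHom_stdRep hp α t ht hr h g b
    · intro b
      change CycRing p R at b
      change L.φ (1 ⊗ₜ[S] F (baseChangeEquiv p R S (1 ⊗ₜ[R] b))) =
        baseChangeEquiv p R (ZMod p) (1 ⊗ₜ[R] b)
      rw [baseChangeEquiv_tmul, baseChangeEquiv_tmul, one_smul, one_smul, hφ, mapHom_comp, ← hα]
      rfl

end CycRing

/-! ### The ring `Z_p ×_{F_p} F_p[[X]]`: presentation and completeness. -/

section

open PowerSeries

/-- The ring `ℤ_p ×_{F_p} F_p⟦X⟧`. -/
def PullbackRing (p : ℕ) [Fact p.Prime] : Type :=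
  RingHom.eqLocus ((PadicInt.toZMod (p := p)).comp (RingHom.fst ℤ_[p] (ZMod p)⟦X⟧))
    ((constantCoeff (R := ZMod p)).comp (RingHom.snd ℤ_[p] (ZMod p)⟦X⟧))

namespace PullbackRing

variable (p : ℕ) [Fact p.Prime]

noncomputable instance : CommRing (PullbackRing p) :=
  inferInstanceAs (CommRing (RingHom.eqLocus _ _))

/-- The first projection. -/
noncomputable def fst : PullbackRing p →+* ℤ_[p] :=
  (RingHom.fst ℤ_[p] (ZMod p)⟦X⟧).comp (Subring.subtype _)

/-- The second projection. -/
noncomputable def snd : PullbackRing p →+* (ZMod p)⟦X⟧ :=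
  (RingHom.snd ℤ_[p] (ZMod p)⟦X⟧).comp (Subring.subtype _)

noncomputable instance : Algebra (PullbackRing p) (ZMod p) :=
  ((PadicInt.toZMod (p := p)).comp (fst p)).toAlgebra

variable {p}

lemma algebraMap_apply (x : PullbackRing p) :
    algebraMap (PullbackRing p) (ZMod p) x = PadicInt.toZMod (fst p x) := rfl

lemma toZMod_fst (x : PullbackRing p) :
    PadicInt.toZMod (fst p x) = constantCoeff (snd p x) := x.2

@[ext] lemma ext {x y : PullbackRing p} (h1 : fst p x = fst p y) (h2 : snd p x = snd p y) :
    x = y := Subtype.ext (Prod.ext h1 h2)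

lemma exists_of_eq {a : ℤ_[p]} {f : (ZMod p)⟦X⟧} (h : PadicInt.toZMod a = constantCoeff f) :
    ∃ x : PullbackRing p, fst p x = a ∧ snd p x = f := ⟨⟨(a, f), h⟩, rfl, rfl⟩

lemma _root_.PadicInt.toZMod_surjective : Function.Surjective (PadicInt.toZMod (p := p)) :=
  ZMod.ringHom_surjective _

lemma fst_surjective : Function.Surjective (fst p) := fun a =>
  let ⟨x, hx, _⟩ := exists_of_eq (a := a) (f := C (PadicInt.toZMod a)) (by simp)
  ⟨x, hx⟩

lemma snd_surjective : Function.Surjective (snd p) := fun f =>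
  let ⟨_, ha⟩ := PadicInt.toZMod_surjective (constantCoeff f)
  let ⟨x, _, hx⟩ := exists_of_eq ha
  ⟨x, hx⟩

lemma toZMod_eq_zero_iff {a : ℤ_[p]} : PadicInt.toZMod a = 0 ↔ (p : ℤ_[p]) ∣ a := by
  rw [← RingHom.mem_ker, PadicInt.ker_toZMod, PadicInt.maximalIdeal_eq_span_p,
    Ideal.mem_span_singleton]

variable (p) in
/-- The element `(0, X)`. -/
noncomputable def t : PullbackRing p := ⟨(0, X), by simp [RingHom.eqLocus]⟩

@[simp] lemma fst_t : fst p (t p) = 0 := rfl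
@[simp] lemma snd_t : snd p (t p) = X := rfl

lemma p_mul_t : (p : PullbackRing p) * t p = 0 := by
  ext1
  · simp
  · rw [map_mul, map_natCast, ← map_natCast (C (R := ZMod p)), ZMod.natCast_self]
    simp

lemma algebraMap_t : algebraMap (PullbackRing p) (ZMod p) (t p) = 0 := by
  simp [algebraMap_apply]

variable (p) in
/-- The map `ℤ_p⟦X⟧ → ℤ_p ×_{F_p} F_p⟦X⟧`. -/
noncomputable def ofPowerSeries : ℤ_[p]⟦X⟧ →+* PullbackRing p :=
  ((constantCoeff (R := ℤ_[p])).prod (PowerSeries.map PadicInt.toZMod)).codRestrict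
    (RingHom.eqLocus _ _) (fun f => by
      change PadicInt.toZMod (constantCoeff f) = constantCoeff
        (PowerSeries.map PadicInt.toZMod f)
      rw [← coeff_zero_eq_constantCoeff_apply, ← coeff_zero_eq_constantCoeff_apply, coeff_map])

@[simp] lemma fst_ofPowerSeries (f : ℤ_[p]⟦X⟧) : fst p (ofPowerSeries p f) = constantCoeff f := rfl
@[simp] lemma snd_ofPowerSeries (f : ℤ_[p]⟦X⟧) :
    snd p (ofPowerSeries p f) = PowerSeries.map PadicInt.toZMod f := rfl

lemma ofPowerSeries_X : ofPowerSeries p X = t p := by ext1 <;> simp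

lemma ofPowerSeries_surjective : Function.Surjective (ofPowerSeries p) := by
  intro x
  choose lift hlift using PadicInt.toZMod_surjective (p := p)
  refine ⟨mk fun n => if n = 0 then fst p x else lift (coeff n (snd p x)), ?_⟩
  ext1
  · rw [fst_ofPowerSeries, ← coeff_zero_eq_constantCoeff_apply, coeff_mk, if_pos rfl]
  · ext n
    rw [snd_ofPowerSeries, coeff_map, coeff_mk]
    split_ifs with h
    · rw [h, toZMod_fst, coeff_zero_eq_constantCoeff_apply]
    · rw [hlift]

lemma ker_ofPowerSeries : RingHom.ker (ofPowerSeries p) = Ideal.span {C (p : ℤ_[p]) * X} := by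
  ext f
  rw [RingHom.mem_ker, Ideal.mem_span_singleton]
  constructor
  · intro h
    have h1 : constantCoeff f = 0 := by rw [← fst_ofPowerSeries, h, map_zero]
    obtain ⟨g, rfl⟩ := X_dvd_iff.2 h1
    have h2 : ∀ n, (p : ℤ_[p]) ∣ coeff n g := by
      intro n
      rw [← toZMod_eq_zero_iff]
      have := congrArg (fun x => coeff (n + 1) (snd p x)) h
      simpa [coeff_succ_X_mul] using this
    choose c hc using h2
    refine ⟨mk c, ?_⟩
    have : g = C (p : ℤ_[p]) * mk c := by
      ext n
      rw [coeff_C_mul, coeff_mk, hc]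
    rw [this]; ring
  · rintro ⟨g, rfl⟩
    rw [map_mul, map_mul, ofPowerSeries_X, map_natCast, map_natCast,
      p_mul_t, zero_mul]

variable (p) in
/-- The presentation `ℤ_p⟦X⟧ / (p X)`. -/
noncomputable def equivQuotient :
    PullbackRing p ≃+* ℤ_[p]⟦X⟧ ⧸ Ideal.span {C (p : ℤ_[p]) * X} :=
  ((Ideal.quotEquivOfEq ker_ofPowerSeries.symm).trans
    (RingHom.quotientKerEquivOfSurjective ofPowerSeries_surjective)).symm

instance : Nontrivial (PullbackRing p) := (algebraMap (PullbackRing p) (ZMod p)).domain_nontrivial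

instance : IsLocalRing (PullbackRing p) :=
  IsLocalRing.of_surjective' (ofPowerSeries p) ofPowerSeries_surjective

instance : IsNoetherianRing (PullbackRing p) :=
  isNoetherianRing_of_surjective _ _ (ofPowerSeries p) ofPowerSeries_surjective

lemma residue_surjective : Function.Surjective (algebraMap (PullbackRing p) (ZMod p)) :=
  ZMod.ringHom_surjective _

lemma mem_maximalIdeal {x : PullbackRing p} :
    x ∈ IsLocalRing.maximalIdeal (PullbackRing p) ↔ PadicInt.toZMod (fst p x) = 0 := by
  rw [← IsLocalRing.eq_maximalIdeal
    (RingHom.ker_isMaximal_of_surjective (algebraMap (PullbackRing p) (ZMod p)) residue_surjective),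
    RingHom.mem_ker, algebraMap_apply]

lemma exists_of_dvd {x : PullbackRing p} {n : ℕ} (hn : n ≠ 0) (h1 : (p : ℤ_[p]) ^ n ∣ fst p x)
    (h2 : X ^ n ∣ snd p x) : ∃ a b : PullbackRing p, x = p ^ n * a + t p ^ n * b := by
  obtain ⟨a, ha⟩ := h1
  obtain ⟨f, hf⟩ := h2
  obtain ⟨a, rfl⟩ := fst_surjective a
  obtain ⟨b, rfl⟩ := snd_surjective f
  refine ⟨a, b, ?_⟩
  have hp : (p : (ZMod p)⟦X⟧) = 0 := by
    rw [← map_natCast (C (R := ZMod p)), ZMod.natCast_self, map_zero]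
  ext1
  · simp [ha, hn]
  · simp [hf, hn, hp]

/-- The maximal ideal is `(p, t)` and `pt = 0`, so its `n`-th power is `(p^n, t^n)`. The adic
topology is thus induced from the two factors, and completeness reduces to theirs. -/
lemma mem_maximalIdeal_pow {x : PullbackRing p} {n : ℕ} (hn : n ≠ 0) :
    x ∈ IsLocalRing.maximalIdeal (PullbackRing p) ^ n ↔
      (p : ℤ_[p]) ^ n ∣ fst p x ∧ X ^ n ∣ snd p x := by
  constructor
  · intro h
    have h1 : IsLocalRing.maximalIdeal (PullbackRing p) ≤
        (Ideal.span {(p : ℤ_[p])}).comap (fst p) := fun y hy => by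
      rw [Ideal.mem_comap, Ideal.mem_span_singleton]
      exact toZMod_eq_zero_iff.1 (mem_maximalIdeal.1 hy)
    have h2 : IsLocalRing.maximalIdeal (PullbackRing p) ≤
        (Ideal.span {(X : (ZMod p)⟦X⟧)}).comap (snd p) := fun y hy => by
      rw [Ideal.mem_comap, Ideal.mem_span_singleton, X_dvd_iff, ← toZMod_fst]
      exact mem_maximalIdeal.1 hy
    have h3 := Ideal.le_comap_pow (fst p) n (Ideal.pow_right_mono h1 n h)
    have h4 := Ideal.le_comap_pow (snd p) n (Ideal.pow_right_mono h2 n h)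
    rw [Ideal.mem_comap, Ideal.span_singleton_pow, Ideal.mem_span_singleton] at h3 h4
    exact ⟨h3, h4⟩
  · rintro ⟨h1, h2⟩
    obtain ⟨a, b, rfl⟩ := exists_of_dvd hn h1 h2
    refine add_mem (Ideal.mul_mem_right _ _ (Ideal.pow_mem_pow ?_ n))
      (Ideal.mul_mem_right _ _ (Ideal.pow_mem_pow ?_ n))
    · rw [mem_maximalIdeal]; simp
    · rw [mem_maximalIdeal]; simp

/-- Iterating this expansion shows that a homomorphism to a complete ring is determined by the image
of `t`. -/
lemma exists_eq_natCast_add (x : PullbackRing p) :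
    ∃ (n : ℕ) (a b : PullbackRing p), x = n + p * a + t p * b := by
  let n := (algebraMap (PullbackRing p) (ZMod p) x).val
  have h : x - n ∈ IsLocalRing.maximalIdeal (PullbackRing p) ^ 1 := by
    rw [pow_one, mem_maximalIdeal, map_sub, map_sub, ← algebraMap_apply, map_natCast, map_natCast,
      ZMod.natCast_zmod_val, sub_self]
  obtain ⟨h1, h2⟩ := (mem_maximalIdeal_pow one_ne_zero).1 h
  obtain ⟨a, b, hab⟩ := exists_of_dvd one_ne_zero h1 h2
  refine ⟨n, a, b, ?_⟩
  rw [pow_one, pow_one] at hab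
  rw [add_assoc, ← hab]; ring

instance : IsAdicComplete (IsLocalRing.maximalIdeal (PullbackRing p)) (PullbackRing p) where
  haus' x hx := by
    simp only [smul_eq_mul, Ideal.mul_top, SModEq.zero] at hx
    ext1
    · rw [map_zero]
      apply IsHausdorff.haus (inferInstance : IsHausdorff (IsLocalRing.maximalIdeal ℤ_[p]) ℤ_[p])
      intro n
      simp only [smul_eq_mul, Ideal.mul_top, SModEq.zero, PadicInt.maximalIdeal_eq_span_p,
        Ideal.span_singleton_pow, Ideal.mem_span_singleton]
      exact (pow_dvd_pow _ n.le_succ).trans ((mem_maximalIdeal_pow n.succ_ne_zero).1 (hx _)).1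
    · rw [map_zero]
      ext n
      rw [map_zero]
      exact X_pow_dvd_iff.1 ((mem_maximalIdeal_pow n.succ_ne_zero).1 (hx _)).2 n n.lt_succ_self
  prec' x hx := by
    simp only [smul_eq_mul, Ideal.mul_top, SModEq.sub_mem] at hx ⊢
    have hx1 : ∀ {m n}, m ≤ n → (p : ℤ_[p]) ^ m ∣ fst p (x m) - fst p (x n) := by
      intro m n hmn
      rcases eq_or_ne m 0 with rfl | hm
      · simp
      · simpa using ((mem_maximalIdeal_pow hm).1 (hx hmn)).1
    have hx2 : ∀ {m n}, m ≤ n → X ^ m ∣ snd p (x m) - snd p (x n) := by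
      intro m n hmn
      rcases eq_or_ne m 0 with rfl | hm
      · simp
      · simpa using ((mem_maximalIdeal_pow hm).1 (hx hmn)).2
    obtain ⟨a, ha⟩ := IsPrecomplete.prec
      (inferInstance : IsPrecomplete (IsLocalRing.maximalIdeal ℤ_[p]) ℤ_[p])
      (f := fun n => fst p (x n)) (fun {m n} hmn => by
        simpa only [smul_eq_mul, Ideal.mul_top, SModEq.sub_mem, PadicInt.maximalIdeal_eq_span_p,
          Ideal.span_singleton_pow, Ideal.mem_span_singleton] using hx1 hmn)
    obtain ⟨f, hf⟩ := IsPrecomplete.prec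
      (inferInstance : IsPrecomplete (Ideal.span {(X : (ZMod p)⟦X⟧)}) (ZMod p)⟦X⟧)
      (f := fun n => snd p (x n)) (fun {m n} hmn => by
        simpa only [smul_eq_mul, Ideal.mul_top, SModEq.sub_mem,
          Ideal.span_singleton_pow, Ideal.mem_span_singleton] using hx2 hmn)
    simp only [smul_eq_mul, Ideal.mul_top, SModEq.sub_mem, PadicInt.maximalIdeal_eq_span_p,
      Ideal.span_singleton_pow, Ideal.mem_span_singleton] at ha hf
    -- The two limits agree in `F_p`, because each agrees there with the first term of the sequence.
    obtain ⟨y, rfl, rfl⟩ : ∃ y : PullbackRing p, fst p y = a ∧ snd p y = f := by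
      apply exists_of_eq
      have h1 := ha 1
      have h2 := hf 1
      rw [pow_one, ← toZMod_eq_zero_iff, map_sub, sub_eq_zero] at h1
      rw [pow_one, X_dvd_iff, map_sub, sub_eq_zero] at h2
      rw [← h1, ← h2, toZMod_fst]
    refine ⟨y, fun n => ?_⟩
    rcases eq_or_ne n 0 with rfl | hn
    · simp
    · rw [mem_maximalIdeal_pow hn, map_sub, map_sub]
      exact ⟨ha n, hf n⟩

instance : IsCoefficientRing (ZMod p) (PullbackRing p) where
  residue_surjective := residue_surjective
  complete := inferInstance

end PullbackRing

/-! ### Homomorphisms to complete local rings. -/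

/-- Evaluation of power series at a nilpotent element. -/
noncomputable def PowerSeries.evalNilpotent {A B : Type*} [CommRing A] [CommRing B] (φ : A →+* B)
    (r : B) (n : ℕ) (hr : r ^ n = 0) : A⟦X⟧ →+* B where
  toFun f := (trunc n f).eval₂ φ r
  map_zero' := by simp
  map_add' f g := by rw [map_add, Polynomial.eval₂_add]
  map_one' := by
    rcases n with _ | n
    · have : Subsingleton B := subsingleton_of_zero_eq_one (by simpa using hr.symm)
      exact Subsingleton.elim _ _
    · rw [trunc_one, Polynomial.eval₂_one]
  map_mul' f g := by
    rw [← Polynomial.eval₂_mul, ← sub_eq_zero, ← Polynomial.eval₂_sub]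
    have h : Polynomial.X ^ n ∣ trunc n (f * g) - trunc n f * trunc n g := by
      rw [Polynomial.X_pow_dvd_iff]
      intro d hd
      rw [Polynomial.coeff_sub, coeff_trunc, if_pos hd, sub_eq_zero,
        coeff_mul_eq_coeff_trunc_mul_trunc f g hd, ← Polynomial.coe_mul, Polynomial.coeff_coe]
    obtain ⟨q, hq⟩ := h
    rw [hq, Polynomial.eval₂_mul, Polynomial.eval₂_X_pow, hr, zero_mul]

lemma PowerSeries.evalNilpotent_apply {A B : Type*} [CommRing A] [CommRing B] (φ : A →+* B)
    (r : B) (n : ℕ) (hr : r ^ n = 0) (f : A⟦X⟧) :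
    evalNilpotent φ r n hr f = (trunc n f).eval₂ φ r := rfl

lemma PowerSeries.eval₂_trunc_of_le {A B : Type*} [CommRing A] [CommRing B] (φ : A →+* B)
    (r : B) {m n : ℕ} (hmn : m ≤ n) (hr : r ^ m = 0) (f : A⟦X⟧) :
    (trunc n f).eval₂ φ r = (trunc m f).eval₂ φ r := by
  rw [← sub_eq_zero, ← Polynomial.eval₂_sub]
  have h : Polynomial.X ^ m ∣ trunc n f - trunc m f := by
    rw [Polynomial.X_pow_dvd_iff]
    intro d hd
    rw [Polynomial.coeff_sub, coeff_trunc, coeff_trunc, if_pos hd, if_pos (by omega), sub_self]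
  obtain ⟨q, hq⟩ := h
  rw [hq, Polynomial.eval₂_mul, Polynomial.eval₂_X_pow, hr, zero_mul]

/-- In an adically complete ring, power series can be evaluated at elements of the ideal. -/
lemma PowerSeries.exists_eval_of_isAdicComplete {A S : Type*} [CommRing A] [CommRing S]
    (I : Ideal S) [IsAdicComplete I S] (φ : A →+* S) {r : S} (hr : r ∈ I) :
    ∃ α : A⟦X⟧ →+* S, α X = r ∧ ∀ a, α (C a) = φ a := by
  have hrn : ∀ n, Ideal.Quotient.mk (I ^ n) r ^ n = 0 := fun n => by
    rw [← map_pow, Ideal.Quotient.eq_zero_iff_mem]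
    exact Ideal.pow_mem_pow hr n
  let ψ : ∀ n, A⟦X⟧ →+* S ⧸ I ^ n := fun n =>
    evalNilpotent ((Ideal.Quotient.mk (I ^ n)).comp φ) _ n (hrn n)
  have hψ : ∀ {m n : ℕ} (hle : m ≤ n), (Ideal.Quotient.factorPow I hle).comp (ψ n) = ψ m := by
    intro m n hle
    ext f
    simp only [ψ, RingHom.comp_apply, evalNilpotent_apply, Polynomial.hom_eval₂]
    rw [← RingHom.comp_assoc]
    exact eval₂_trunc_of_le _ _ hle (hrn m) f
  let α := IsAdicComplete.liftRingHom I ψ hψ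
  have hα : ∀ n f, Ideal.Quotient.mk (I ^ n) (α f) = ψ n f :=
    fun n f => IsAdicComplete.mk_liftRingHom I ψ hψ n f
  -- The shift by `2` ensures that truncation leaves `X` and the constants unchanged.
  have hsep : ∀ x y : S, (∀ n, Ideal.Quotient.mk (I ^ (n + 2)) x = Ideal.Quotient.mk _ y) →
      x = y := by
    intro x y h
    rw [← sub_eq_zero]
    apply IsHausdorff.haus (inferInstance : IsHausdorff I S)
    intro n
    simp only [smul_eq_mul, Ideal.mul_top, SModEq.zero]
    exact Ideal.pow_le_pow_right (by omega : n ≤ n + 2) (Ideal.Quotient.eq.1 (h n))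
  refine ⟨α, hsep _ _ fun n => ?_, fun a => hsep _ _ fun n => ?_⟩
  · rw [hα, evalNilpotent_apply, trunc_X, Polynomial.eval₂_X]
  · rw [hα, evalNilpotent_apply, trunc_C, Polynomial.eval₂_C]
    rfl

/-- `p^n` vanishes in `S/I^n`, so `Z_p → Z/p^n → S/I^n` is defined; these maps are compatible
because homomorphisms out of `Z/p^n` are unique. -/
lemma PadicInt.exists_ringHom_of_isAdicComplete {p : ℕ} [Fact p.Prime] {S : Type*} [CommRing S]
    (I : Ideal S) [IsAdicComplete I S] (hp : (p : S) ∈ I) : Nonempty (ℤ_[p] →+* S) := by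
  have hchar : ∀ n : ℕ, ringChar (S ⧸ I ^ n) ∣ p ^ n := fun n => by
    rw [← CharP.cast_eq_zero_iff (S ⧸ I ^ n) (ringChar (S ⧸ I ^ n)), Nat.cast_pow,
      ← map_natCast (Ideal.Quotient.mk (I ^ n)), ← map_pow, Ideal.Quotient.eq_zero_iff_mem]
    exact Ideal.pow_mem_pow hp n
  let φ : ∀ n, ℤ_[p] →+* S ⧸ I ^ n := fun n =>
    (ZMod.castHom (hchar n) (S ⧸ I ^ n)).comp (PadicInt.toZModPow n)
  refine ⟨IsAdicComplete.liftRingHom I φ fun {m n} hle => ?_⟩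
  simp only [φ]
  rw [← PadicInt.zmod_cast_comp_toZModPow m n hle, ← RingHom.comp_assoc, ← RingHom.comp_assoc]
  congr 1
  exact Subsingleton.elim _ _

namespace PullbackRing

variable {p : ℕ} [Fact p.Prime] {S : Type u} [CommRing S] [Algebra S (ZMod p)]
  [IsCoefficientRing (ZMod p) S]

/-- Homomorphisms to coefficient rings correspond to the elements of the maximal ideal killed
by `p`. -/
theorem existsUnique_ringHom {r : S} (hrm : r ∈ IsLocalRing.maximalIdeal S)
    (hr : (p : S) * r = 0) :
    ∃! α : PullbackRing p →+* S,
      (algebraMap S (ZMod p)).comp α = algebraMap (PullbackRing p) (ZMod p) ∧ α (t p) = r := by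
  have hcomplete : IsAdicComplete (IsLocalRing.maximalIdeal S) S :=
    IsCoefficientRing.complete (k := ZMod p)
  have hpS : (p : S) ∈ IsLocalRing.maximalIdeal S := by
    rw [IsCoefficientRing.mem_maximalIdeal (k := ZMod p), map_natCast, ZMod.natCast_self]
  obtain ⟨φ⟩ := PadicInt.exists_ringHom_of_isAdicComplete _ hpS
  obtain ⟨α₀, hX, -⟩ := PowerSeries.exists_eval_of_isAdicComplete _ φ hrm
  have hker : RingHom.ker (ofPowerSeries p) ≤ RingHom.ker α₀ := by
    rw [ker_ofPowerSeries, Ideal.span_singleton_le_iff_mem, RingHom.mem_ker, map_mul, hX,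
      map_natCast, map_natCast, hr]
  let α : PullbackRing p →+* S :=
    (ofPowerSeries p).liftOfSurjective ofPowerSeries_surjective ⟨α₀, hker⟩
  have hαt : α (t p) = r := by
    rw [← ofPowerSeries_X, ← hX]
    exact RingHom.liftOfRightInverse_comp_apply _ _ _ ⟨α₀, hker⟩ _
  refine ⟨α, ⟨?_, hαt⟩, ?_⟩
  · ext x
    obtain ⟨n, a, b, rfl⟩ := exists_eq_natCast_add x
    have h0 := (IsCoefficientRing.mem_maximalIdeal (k := ZMod p)).1 hrm
    simp [hαt, h0, algebraMap_t]
  · rintro β ⟨-, hβt⟩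
    -- Both maps agree on `n`, `p` and `t`, so each use of the expansion gains one power of the
    -- maximal ideal; separatedness concludes.
    have key : ∀ n x, β x - α x ∈ IsLocalRing.maximalIdeal S ^ n := by
      intro n
      induction n with
      | zero => simp
      | succ n ih =>
        intro x
        obtain ⟨m, a, b, rfl⟩ := exists_eq_natCast_add x
        have h : β (m + p * a + t p * b) - α (m + p * a + t p * b) =
            p * (β a - α a) + r * (β b - α b) := by
          simp only [map_add, map_mul, map_natCast, hβt, hαt]
          ring
        rw [h, pow_succ']
        exact add_mem (Ideal.mul_mem_mul hpS (ih a)) (Ideal.mul_mem_mul hrm (ih b))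
    ext x
    rw [← sub_eq_zero]
    apply IsHausdorff.haus hcomplete.toIsHausdorff
    intro n
    simp only [smul_eq_mul, Ideal.mul_top, SModEq.zero]
    exact key n x

end PullbackRing

end

/-! ### Universality, then uniseriality, length and endomorphisms of `V`. -/

namespace CycRing

variable {p : ℕ} [Fact p.Prime]

theorem isUniversalDeformationRing (hp : 3 ≤ p) :
    IsUniversalDeformationRing.{0, v} (stdRep hp (0 : ZMod p) (mul_zero _)) (PullbackRing p) := by
  refine ⟨inferInstance, stdLift hp (PullbackRing.t p) PullbackRing.p_mul_t
    PullbackRing.algebraMap_t, ?_⟩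
  intro S _ _ _ L
  obtain ⟨r, hrm, hr, h⟩ := exists_arisesFrom_iff hp PullbackRing.p_mul_t
    PullbackRing.algebraMap_t L
  obtain ⟨α, ⟨hα, hαt⟩, huniq⟩ := PullbackRing.existsUnique_ringHom hrm hr
  exact ⟨α, ⟨hα, (h α hα).2 hαt⟩, fun β ⟨hβ, hβL⟩ => huniq β ⟨hβ, (h β hβ).1 hβL⟩⟩

end CycRing

namespace CycRing

variable {p : ℕ} [Fact p.Prime]

lemma unif_pow_eq_zero {n : ℕ} (hn : p - 1 ≤ n) : unif p (ZMod p) ^ n = 0 := by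
  simpa using smul_unif_pow_eq_zero (S := ZMod p) (p := p) (r := 1) (by simp) hn

/-- Peel off factors `π` until the value at `ζ = 1` is nonzero; the cofactor is then a unit because
`π` is nilpotent. Zero is `π^(p-1) · 1`. -/
lemma exists_eq_unif_pow_mul_unit (b : CycRing p (ZMod p)) :
    ∃ (j : ℕ) (u : CycRing p (ZMod p)), IsUnit u ∧ b = unif p (ZMod p) ^ j * u := by
  have key : ∀ n : ℕ, (∃ (j : ℕ) (u : CycRing p (ZMod p)),
      IsUnit u ∧ b = unif p (ZMod p) ^ j * u) ∨ unif p (ZMod p) ^ n ∣ b := by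
    intro n
    induction n with
    | zero => simp
    | succ n ih =>
      rcases ih with h | ⟨c, rfl⟩
      · exact Or.inl h
      · obtain ⟨s, d, rfl⟩ := exists_eq_smul_one_add c
        rcases eq_or_ne s 0 with rfl | hs
        · exact Or.inr ⟨d, by rw [zero_smul, zero_add, ← mul_assoc, pow_succ]⟩
        · refine Or.inl ⟨n, _, ?_, rfl⟩
          have h1 : IsNilpotent (unif p (ZMod p) * d) :=
            ⟨p - 1, by rw [mul_pow, unif_pow_eq_zero le_rfl, zero_mul]⟩
          have h2 : IsUnit (s • (1 : CycRing p (ZMod p))) := by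
            rw [← Algebra.algebraMap_eq_smul_one]
            exact (IsUnit.mk0 s hs).map _
          exact h1.isUnit_add_left_of_commute h2 (Commute.all _ _)
  rcases key (p - 1) with h | ⟨c, hc⟩
  · exact h
  · exact ⟨p - 1, 1, isUnit_one, by rw [hc, unif_pow_eq_zero le_rfl]; simp⟩

variable (hp : 3 ≤ p)

local notation "ρ₀" => stdRep hp (0 : ZMod p) (mul_zero _)

/-- Stability under `x` alone makes a subrepresentation an ideal. -/
lemma mul_mem_subrepresentation (W : Subrepresentation ρ₀) (f : CycRing p (ZMod p))
    {b : CycRing p (ZMod p)} (hb : b ∈ W) : f * b ∈ W := by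
  induction f using AdjoinRoot.induction_on with | ih f =>
  induction f using Polynomial.induction_on' with
  | add f g hf hg =>
    rw [map_add, add_mul]
    exact W.toSubmodule.add_mem hf hg
  | monomial n s =>
    have h : zeta p (ZMod p) ^ n * b ∈ W := by
      induction n with
      | zero => simpa using hb
      | succ n ih =>
        rw [pow_succ', mul_assoc, ← stdRep_x hp (mul_zero _)]
        exact W.apply_mem_toSubmodule _ ih
    have h1 : AdjoinRoot.mk (Polynomial.cyclotomic p (ZMod p)) (Polynomial.monomial n s) * b =
        s • (zeta p (ZMod p) ^ n * b) := by
      rw [← Polynomial.C_mul_X_pow_eq_monomial, map_mul, map_pow, AdjoinRoot.mk_X, AdjoinRoot.mk_C,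
        Algebra.smul_def, AdjoinRoot.algebraMap_eq, mul_assoc]
    rw [h1]
    exact W.toSubmodule.smul_mem _ h

lemma subrepresentation_le_total (W₁ W₂ : Subrepresentation ρ₀) : W₁ ≤ W₂ ∨ W₂ ≤ W₁ := by
  by_contra! h
  obtain ⟨h1, h2⟩ := h
  obtain ⟨b, hb1, hb2⟩ := Set.not_subset.1 h1
  obtain ⟨c, hc2, hc1⟩ := Set.not_subset.1 h2
  obtain ⟨j, u, hu, rfl⟩ := exists_eq_unif_pow_mul_unit b
  obtain ⟨l, v, hv, rfl⟩ := exists_eq_unif_pow_mul_unit c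
  obtain ⟨u, rfl⟩ := hu
  obtain ⟨v, rfl⟩ := hv
  rcases le_total j l with hjl | hjl
  · apply hc1
    have := mul_mem_subrepresentation hp W₁ (unif p (ZMod p) ^ (l - j) * v * ↑u⁻¹) hb1
    refine (congrArg (· ∈ W₁) ?_).mp this
    have h3 := u.mul_inv
    have h4 : unif p (ZMod p) ^ l = unif p (ZMod p) ^ (l - j) * unif p (ZMod p) ^ j := by
      rw [← pow_add]; congr 1; omega
    rw [h4]
    linear_combination ((unif p (ZMod p) ^ (l - j) * unif p (ZMod p) ^ j * v)) * h3
  · apply hb2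
    have := mul_mem_subrepresentation hp W₂ (unif p (ZMod p) ^ (j - l) * u * ↑v⁻¹) hc2
    refine (congrArg (· ∈ W₂) ?_).mp this
    have h3 := v.mul_inv
    have h4 : unif p (ZMod p) ^ j = unif p (ZMod p) ^ (j - l) * unif p (ZMod p) ^ l := by
      rw [← pow_add]; congr 1; omega
    rw [h4]
    linear_combination ((unif p (ZMod p) ^ (j - l) * unif p (ZMod p) ^ l * u)) * h3

theorem isUniserialModule :
    IsUniserialModule (MonoidAlgebra (ZMod p) (DiagGroup p)) (Representation.asModule ρ₀) := by
  intro N₁ N₂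
  let E := Subrepresentation.subrepresentationSubmoduleOrderIso (ρ := ρ₀)
  have := subrepresentation_le_total hp (E.symm N₁) (E.symm N₂)
  simpa using this

/-- The subrepresentation generated by `(ζ - 1) ^ i`. -/
noncomputable def unifSub (i : ℕ) : Subrepresentation ρ₀ where
  toSubmodule := LinearMap.range (LinearMap.mulLeft (ZMod p) (unif p (ZMod p) ^ i))
  apply_mem_toSubmodule g b hb := by
    obtain ⟨c, rfl⟩ := hb
    obtain ⟨v, hv⟩ := exists_galois_unif (S := ZMod p) g.right
    rw [LinearMap.mulLeft_apply, stdRep_apply, map_mul, map_pow, hv]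
    rw [mul_pow, mul_assoc (unif p (ZMod p) ^ i), mul_left_comm]
    exact ⟨_, rfl⟩

lemma mem_unifSub {i : ℕ} {b : CycRing p (ZMod p)} : b ∈ unifSub hp i ↔ unif p (ZMod p) ^ i ∣ b :=
  ⟨fun ⟨c, hc⟩ => ⟨c, hc.symm⟩, fun ⟨c, hc⟩ => ⟨c, hc.symm⟩⟩

lemma unifSub_lt {i : ℕ} (hi : i < p - 1) : unifSub hp (i + 1) < unifSub hp i := by
  refine lt_of_le_not_ge (fun b hb => ?_) fun h => ?_
  · rw [mem_unifSub] at hb ⊢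
    exact (pow_dvd_pow _ i.le_succ).trans hb
  · have h1 : unif p (ZMod p) ^ i ∈ unifSub hp (i + 1) := h ((mem_unifSub hp).2 dvd_rfl)
    obtain ⟨c, hc⟩ := (mem_unifSub hp).1 h1
    -- If `π^i` were a multiple of `π^(i+1)`, then `π^(p-2)` would be one of `π^(p-1) = 0`, against
    -- its top coefficient `1`.
    have h2 : unif p (ZMod p) ^ (p - 2) = 0 := by
      have h3 : p - 2 = (p - 2 - i) + i := by omega
      rw [h3, pow_add, hc, ← mul_assoc, ← pow_add, unif_pow_eq_zero (by omega), zero_mul]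
    have h4 := topCoeff_unif p (ZMod p)
    rw [h2, map_zero] at h4
    exact zero_ne_one h4

/-- The dimension over `F_p` bounds the length above; the chain of powers of `π` attains it. -/
theorem length_eq : Module.length (MonoidAlgebra (ZMod p) (DiagGroup p))
    (Representation.asModule ρ₀) = ((p - 1 : ℕ) : ℕ∞) := by
  let E := Subrepresentation.subrepresentationSubmoduleOrderIso (ρ := ρ₀)
  apply le_antisymm
  · have h1 : Module.length (ZMod p) (CycRing p (ZMod p)) = ((p - 1 : ℕ) : ℕ∞) := by
      rw [Module.length_eq_finrank, finrank_eq]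
    rw [← h1, ← WithBot.coe_le_coe, Module.coe_length, Module.coe_length]
    refine Order.krullDim_le_of_strictMono (fun N => (E.symm N).toSubmodule) ?_
    intro N₁ N₂ h
    exact E.symm.strictMono h
  · let s : LTSeries (Submodule (MonoidAlgebra (ZMod p) (DiagGroup p))
        (Representation.asModule ρ₀)) :=
      { length := p - 1
        toFun := fun i => E (unifSub hp (p - 1 - i))
        step := fun i => by
          apply E.strictMono
          have h1 : p - 1 - (i.castSucc : ℕ) = p - 1 - (i.succ : ℕ) + 1 := by
            simp; omega
          change unifSub hp (p - 1 - (i.castSucc : ℕ)) < unifSub hp (p - 1 - (i.succ : ℕ))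
          rw [h1]
          exact unifSub_lt hp (by simp; omega) }
    rw [← WithBot.coe_le_coe, Module.coe_length]
    exact Order.LTSeries.length_le_krullDim s

/-- For `0 < i < p - 1` some `a` has `a^i ≠ 1`, so the part of `β` divisible by `π` climbs to
`π^(p-1) = 0`. -/
lemma eq_smul_one_of_galois_fixed (hp : 3 ≤ p) {β : CycRing p (ZMod p)}
    (h : ∀ a : (ZMod p)ˣ, galois p (ZMod p) a β = β) : ∃ c : ZMod p, β = c • 1 := by
  obtain ⟨c, d, hβ⟩ := exists_eq_smul_one_add β
  refine ⟨c, ?_⟩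
  have hfix : ∀ a : (ZMod p)ˣ, galois p (ZMod p) a (unif p (ZMod p) * d) =
      unif p (ZMod p) * d := by
    intro a
    have := h a
    rwa [hβ, map_add, map_smul, map_one, add_right_inj] at this
  have key : ∀ i, 1 ≤ i → i ≤ p - 1 → ∃ κ ∈ (⊤ : Ideal (ZMod p)).map
      (algebraMap (ZMod p) (CycRing p (ZMod p))),
      unif p (ZMod p) * d = unif p (ZMod p) ^ i * κ := by
    intro i hi
    induction i, hi using Nat.le_induction with
    | base => exact fun _ => ⟨d, by simp [Ideal.map_top], by rw [pow_one]⟩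
    | succ i hi ih =>
      intro hi'
      obtain ⟨a, ha⟩ := ZMod.exists_unit_pow_ne_one p (i := i) (by omega) (by omega)
      refine leading_term_step ⊤ a i 1 ?_ (ih (by omega)) ⟨0, zero_mem _, by simp [hfix a]⟩
      rw [isUnit_iff_ne_zero, sub_ne_zero, ZMod.natCast_zmod_val]
      exact fun h => ha (Units.ext (by simpa using h))
  obtain ⟨κ, -, hκ⟩ := key (p - 1) (by omega) le_rfl
  rw [hβ, hκ, unif_pow_eq_zero le_rfl, zero_mul, add_zero]

theorem nonempty_end_algEquiv :
    Nonempty (Module.End (MonoidAlgebra (ZMod p) (DiagGroup p)) (Representation.asModule ρ₀)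
      ≃ₐ[ZMod p] ZMod p) := by
  refine ⟨(AlgEquiv.ofBijective (Algebra.ofId (ZMod p) (Module.End
    (MonoidAlgebra (ZMod p) (DiagGroup p)) (Representation.asModule ρ₀))) ⟨?_, fun f => ?_⟩).symm⟩
  · have : Nontrivial (Representation.asModule ρ₀) :=
      Module.nontrivial_of_finrank_pos (R := ZMod p) (M := CycRing p (ZMod p))
        (by rw [finrank_eq]; omega)
    exact RingHom.injective _
  · let f' : CycRing p (ZMod p) → CycRing p (ZMod p) := fun b => f b
    have hf : ∀ g b, f' (ρ₀ g b) = ρ₀ g (f' b) := by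
      intro g b
      have h := f.map_smul (MonoidAlgebra.single g 1) ((Representation.asModuleEquiv ρ₀).symm b)
      rw [Representation.single_smul, Representation.single_smul, one_smul, one_smul] at h
      exact h
    -- The image of the fixed vector `1` is fixed, hence a scalar `c`; commuting with `x` spreads
    -- this to every `ζ^n`.
    obtain ⟨c, hc⟩ := eq_smul_one_of_galois_fixed hp (β := f' 1) fun a => by
      rw [← stdRep_inr hp (mul_zero _), ← hf, stdRep_inr, map_one]
    refine ⟨c, LinearMap.ext fun b => ?_⟩
    let F : CycRing p (ZMod p) →ₗ[ZMod p] CycRing p (ZMod p) :=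
      { toFun := f'
        map_add' := f.map_add
        map_smul' := fun s b => (f.restrictScalars (ZMod p)).map_smul s b }
    have hF : F = c • LinearMap.id := by
      refine (basis p (ZMod p)).ext fun i => ?_
      rw [basis_apply]
      generalize (i : ℕ) = n
      induction n with
      | zero =>
        rw [pow_zero]
        exact hc
      | succ n ih =>
        rw [pow_succ', ← stdRep_x hp (mul_zero _)]
        change f' _ = _
        rw [hf]
        change ρ₀ _ (F _) = _
        rw [ih]
        simp
    exact (DFunLike.congr_fun hF b).symm

end CycRing

/-! ### Reduction modulo `p`, and the theorem. -/

namespace PullbackRing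

open PowerSeries

variable (p : ℕ) [Fact p.Prime]

lemma ker_snd : RingHom.ker (snd p) = Ideal.span {(p : PullbackRing p)} := by
  ext x
  rw [RingHom.mem_ker, Ideal.mem_span_singleton]
  have hp : (p : (ZMod p)⟦X⟧) = 0 := by
    rw [← map_natCast (C (R := ZMod p)), ZMod.natCast_self, map_zero]
  constructor
  · intro h
    have h1 : (p : ℤ_[p]) ∣ fst p x := by
      rw [← toZMod_eq_zero_iff, toZMod_fst, h, map_zero]
    obtain ⟨a, ha⟩ := h1
    obtain ⟨a, rfl⟩ := fst_surjective a
    exact ⟨a, by ext1 <;> simp [ha, h, hp]⟩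
  · rintro ⟨y, rfl⟩
    rw [map_mul, map_natCast, hp, zero_mul]

/-- Reduction modulo `p`. -/
noncomputable def quotientEquiv :
    (PullbackRing p ⧸ Ideal.span {(p : PullbackRing p)}) ≃+* (ZMod p)⟦X⟧ :=
  (Ideal.quotEquivOfEq (ker_snd p).symm).trans
    (RingHom.quotientKerEquivOfSurjective snd_surjective)

lemma exists_algebra_quotient :
    ∃ _ : Algebra (ZMod p) (PullbackRing p ⧸ Ideal.span {(p : PullbackRing p)}),
      Nonempty ((PullbackRing p ⧸ Ideal.span {(p : PullbackRing p)}) ≃ₐ[ZMod p] (ZMod p)⟦X⟧) ∧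
      ¬ Module.Finite (ZMod p) (PullbackRing p ⧸ Ideal.span {(p : PullbackRing p)}) := by
  let A : Algebra (ZMod p) (PullbackRing p ⧸ Ideal.span {(p : PullbackRing p)}) :=
    (((quotientEquiv p).symm : (ZMod p)⟦X⟧ →+* _).comp (C (R := ZMod p))).toAlgebra
  refine ⟨A, ⟨AlgEquiv.ofRingEquiv (f := quotientEquiv p) fun c => ?_⟩, fun h => ?_⟩
  · exact (quotientEquiv p).apply_symm_apply _
  · have h1 := Module.finite_of_finite (ZMod p)
      (M := PullbackRing p ⧸ Ideal.span {(p : PullbackRing p)})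
    have h2 : Finite (ZMod p)⟦X⟧ := Finite.of_equiv _ (quotientEquiv p).toEquiv
    refine not_injective_infinite_finite (fun n : ℕ => (X : (ZMod p)⟦X⟧) ^ n) fun m n hmn => ?_
    have h3 := congrArg (coeff m) hmn
    simpa [coeff_X_pow] using h3

end PullbackRing

theorem proposition2 (p : ℕ) [Fact p.Prime] (hp : 3 ≤ p) :
    ∃ (V : Type) (_ : AddCommGroup V) (_ : Module (ZMod p) V)
      (ρ : Representation (ZMod p) (DiagGroup p) V),
      IsUniserialModule (MonoidAlgebra (ZMod p) (DiagGroup p)) ρ.asModule ∧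
      Module.length (MonoidAlgebra (ZMod p) (DiagGroup p)) ρ.asModule = ((p - 1 : ℕ) : ℕ∞) ∧
      Nonempty (Module.End (MonoidAlgebra (ZMod p) (DiagGroup p)) ρ.asModule ≃ₐ[ZMod p] ZMod p) ∧
      ∃ (R : Type) (_ : CommRing R) (_ : Algebra R (ZMod p)),
        IsUniversalDeformationRing.{0, v} ρ R ∧
        Nonempty (R ≃+* ℤ_[p]⟦X⟧ ⧸ Ideal.span {PowerSeries.C (p : ℤ_[p]) * PowerSeries.X}) ∧
        ∃ _ : Algebra (ZMod p) (R ⧸ Ideal.span {(p : R)}),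
          Nonempty ((R ⧸ Ideal.span {(p : R)}) ≃ₐ[ZMod p] (ZMod p)⟦X⟧) ∧
          ¬ Module.Finite (ZMod p) (R ⧸ Ideal.span {(p : R)}) :=
  ⟨CycRing p (ZMod p), inferInstance, inferInstance, CycRing.stdRep hp 0 (mul_zero _),
    CycRing.isUniserialModule hp, CycRing.length_eq hp, CycRing.nonempty_end_algEquiv hp,
    PullbackRing p, inferInstance, inferInstance, CycRing.isUniversalDeformationRing hp,
    ⟨PullbackRing.equivQuotient p⟩, PullbackRing.exists_algebra_quotient p⟩
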